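/- For $t\ge 1$ and $n\ge 0$ let $A_t(n)$ be the number of ordered pairs $(\lambda,\mu)$ of partitions, both $t$-cores (a partition is a $t$-core if none of the hook numbers of its Ferrers–Young diagram is divisible by $t$; the empty partition is a $t$-core), such that the sum of all parts of $\lambda$ and $\mu$ is $n$. For a positive integer $m$ and $q\in\mathbb{C}$ with $|q|<1$ let $f_m:=\prod_{n\ge 1}(1-q^{mn})$. Define $\{B_k\}_{k\ge 0}$ by $B_0=0$, $B_1=1$ and $$B_k=-4B_{k-1}-8B_{k-2}+\frac{8^k-1}{7}\qquad(k\ge 2).$$ Then for every integer $k\ge 1$ and every $q\in\mathbb{C}$ with $0<|q|<1$, the series on the left below converges and $$\sum_{n=-1}^{\infty}A_5(2^kn+2^{k+1}-2)\,q^n = B_k\frac{f_1^4f_5^4}{q}-8B_{k-1}f_2^4f_{10}^4+\frac{8^{k+1}-1}{7}\cdot\frac{f_5^{10}}{f_1^2}-\frac{8^{k+1}-8}{7}\cdot\frac{q^2f_{10}^{10}}{f_2^2}.$$ -/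

import Mathlib

namespace CorePairs

/-- The hook number of the cell `c` of the diagram `μ`: the number of cells of `μ` weakly to the
right of `c` in its row or weakly below `c` in its column, `c` itself being counted once.
(In `YoungDiagram`, a cell is a pair (row, column), rows being numbered downwards.) -/
def hookNumber (μ : YoungDiagram) (c : ℕ × ℕ) : ℕ :=
  (μ.cells.filter fun d => (d.1 = c.1 ∧ c.2 ≤ d.2) ∨ (d.2 = c.2 ∧ c.1 ≤ d.1)).card

/-- A partition, given by its Young diagram, is a `t`-core if none of its hook numbers is
divisible by `t`. The empty partition is a `t`-core. -/
def IsCore (t : ℕ) (μ : YoungDiagram) : Prop :=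
  ∀ c ∈ μ, ¬ t ∣ hookNumber μ c

/-- The set of ordered pairs of `t`-cores whose sizes add up to `n`. -/
def corePairs (t n : ℕ) : Set (YoungDiagram × YoungDiagram) :=
  {p | IsCore t p.1 ∧ IsCore t p.2 ∧ p.1.card + p.2.card = n}

/-- `A_t(n)`: the number of partition pairs of `n` with `t`-cores (a finite number, see
`corePairs_finite`). -/
noncomputable def A (t n : ℕ) : ℕ := (corePairs t n).ncard

lemma cells_subset_of_card_le {μ : YoungDiagram} {n : ℕ} (h : μ.card ≤ n) :
    μ.cells ⊆ Finset.range n ×ˢ Finset.range n := by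
  rintro ⟨i, j⟩ hc
  rw [YoungDiagram.mem_cells] at hc
  have hrow : μ.rowLen i ≤ μ.card := by
    rw [YoungDiagram.rowLen_eq_card]
    exact Finset.card_le_card (Finset.filter_subset _ _)
  have hcol : μ.colLen j ≤ μ.card := by
    rw [YoungDiagram.colLen_eq_card]
    exact Finset.card_le_card (Finset.filter_subset _ _)
  have h1 := YoungDiagram.mem_iff_lt_rowLen.1 hc
  have h2 := YoungDiagram.mem_iff_lt_colLen.1 hc
  simp only [Finset.mem_product, Finset.mem_range]
  omega

lemma finite_card_le (n : ℕ) : {μ : YoungDiagram | μ.card ≤ n}.Finite := by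
  refine Set.Finite.of_finite_image (f := YoungDiagram.cells)
    (Set.Finite.subset (Finset.finite_toSet (Finset.range n ×ˢ Finset.range n).powerset) ?_) ?_
  · rintro _ ⟨μ, hμ, rfl⟩
    exact Finset.mem_coe.2 (Finset.mem_powerset.2 (cells_subset_of_card_le hμ))
  · intro μ _ ν _ h
    exact YoungDiagram.ext h

lemma corePairs_finite (t n : ℕ) : (corePairs t n).Finite := by
  refine ((finite_card_le n).prod (finite_card_le n)).subset ?_
  rintro ⟨μ, ν⟩ ⟨_, _, h⟩
  simp only at h
  simp only [Set.mem_prod, Set.mem_ofPred_eq]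
  omega

/-- `f_m = ∏_{n ≥ 1} (1 - q^{mn})`; the product index `n` below is shifted by one. -/
noncomputable def f (m : ℕ) (q : ℂ) : ℂ := ∏' n : ℕ, (1 - q ^ (m * (n + 1)))

/-- `B_0 = 0`, `B_1 = 1`, `B_k = -4 B_{k-1} - 8 B_{k-2} + (8^k - 1)/7` for `k ≥ 2`. -/
def B : ℕ → ℚ
  | 0 => 0
  | 1 => 1
  | k + 2 => -4 * B (k + 1) - 8 * B k + (8 ^ (k + 2) - 1) / 7

end CorePairs

/-! Put `corePairGF q` = q² f_5¹⁰/f_1² and `cusp q` = q f_1⁴ f_5⁴. Since 2^k n + 2^{k+1} - 2 = 2^k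
(n+2) - 2, the shift by q² turns the progression of the theorem into the multiples of 2^k. The claim
is therefore about the k-th power of the operator U₂ : ∑ a(m) q^m ↦ ∑ a(2m) q^m applied to
`corePairGF`, followed by division by q².

U₂ acts on a finite-dimensional space: U₂ cusp(q) = -4 cusp(q) - 8 cusp(q²) (`cusp_even_part`), U₂
corePairGF(q) = cusp(q) + 9 corePairGF(q) - 8 corePairGF(q²) (`corePairGF_even_part`), and U₂ sends
g(q²) to g(q). Iterating these rules gives the recurrence for B and the geometric sums in 8
(`iterU_even_part`). Analytically, U₂ g at w² is the average of g(w) and g(-w).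

Both rules are proved with theta functions instead of modular forms. Powers of f_1 and f_5 are
rewritten through φ(±w) and φ(±w⁵), whose 2-dissections are explicit. What remains is a set of level
10 and level 20 identities, obtained by splitting sums of q^{x²+y²} and of q^{T(x)+T(y)}, T
triangular, over ℤ² = ℤ[i] into cosets of (2+i), and from Jacobi's triple product
(`theta_eq_pochInf`).

That f_t^t/f_1 counts t-cores (`hasSum_isCore`) comes from the Maya diagram. A t-core is a bead set
stable under subtraction of t, hence an integer vector of sum zero, with quadratic size. The sum
over such vectors is the constant term in z of a product of t theta series, which the triple product
collapses to f_t^t/f_1 times a single theta series with constant term 1. -/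

namespace CorePairs

/-! ### Infinite products and the functions f_m -/

/-- The infinite product `∏_{n ≥ 0} (1 + a qⁿ)`. -/
noncomputable def pochInf (a q : ℂ) : ℂ := ∏' n : ℕ, (1 + a * q ^ n)

lemma summable_norm_mul_pow (a : ℂ) {q : ℂ} (hq : ‖q‖ < 1) :
    Summable fun n : ℕ => ‖a * q ^ n‖ := by
  simpa [norm_mul, norm_pow] using
    (summable_geometric_of_lt_one (norm_nonneg q) hq).mul_left ‖a‖

lemma multipliable_pochInf (a : ℂ) {q : ℂ} (hq : ‖q‖ < 1) :
    Multipliable fun n : ℕ => 1 + a * q ^ n :=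
  multipliable_one_add_of_summable (summable_norm_mul_pow a hq)

lemma pochInf_ne_zero {a q : ℂ} (hq : ‖q‖ < 1) (h : ∀ n : ℕ, 1 + a * q ^ n ≠ 0) :
    pochInf a q ≠ 0 :=
  tprod_one_add_ne_zero_of_summable h (summable_norm_mul_pow a hq)

lemma pochInf_ne_zero_of_norm_lt_one {a q : ℂ} (hq : ‖q‖ < 1) (ha : ‖a‖ < 1) :
    pochInf a q ≠ 0 := by
  refine pochInf_ne_zero hq fun n h => ?_
  have h1 : a * q ^ n = -1 := by linear_combination h
  have h2 : ‖a * q ^ n‖ < 1 := by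
    rw [norm_mul, norm_pow]
    exact mul_lt_one_of_nonneg_of_lt_one_left (norm_nonneg _) ha
      (pow_le_one₀ (norm_nonneg _) hq.le)
  rw [h1] at h2
  simp at h2

/-- Splitting off the residue classes of the index modulo `k`. -/
lemma pochInf_eq_prod (a : ℂ) {q : ℂ} (hq : ‖q‖ < 1) (k : ℕ) [NeZero k] :
    pochInf a q = ∏ r : Fin k, pochInf (a * q ^ (r : ℕ)) (q ^ k) := by
  have hk : ‖q ^ k‖ < 1 := by
    rw [norm_pow]; exact pow_lt_one₀ (norm_nonneg _) hq (NeZero.ne k)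
  have h2 : HasProd (fun p : Fin k × ℕ => 1 + a * q ^ (p.2 * k + (p.1 : ℕ))) (pochInf a q) := by
    refine HasProd.congr_fun (((Equiv.prodComm _ _).trans (Nat.divModEquiv k).symm).hasProd_iff.mpr
      (multipliable_pochInf a hq).hasProd) fun p => ?_
    simp
  refine (hasProd_fintype _).unique (h2.prod_fiberwise fun r => ?_) |>.symm
  refine HasProd.congr_fun (multipliable_pochInf (a * q ^ (r : ℕ)) hk).hasProd fun n => ?_
  simp only
  ring

lemma pochInf_mul_pochInf_neg (a : ℂ) {q : ℂ} (hq : ‖q‖ < 1) :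
    pochInf a q * pochInf (-a) q = pochInf (-a ^ 2) (q ^ 2) := by
  rw [pochInf, pochInf, ← (multipliable_pochInf a hq).tprod_mul (multipliable_pochInf (-a) hq)]
  exact tprod_congr fun n => by ring

lemma pochInf_succ (a : ℂ) {q : ℂ} (hq : ‖q‖ < 1) :
    pochInf a q = (1 + a) * pochInf (a * q) q := by
  have h : Multipliable fun n : ℕ => 1 + a * q ^ (n + 1) :=
    (multipliable_pochInf (a * q) hq).congr fun n => by ring
  have e := tprod_eq_zero_mul' (f := fun n : ℕ => 1 + a * q ^ n) h
  rw [pochInf, e, pow_zero, mul_one, pochInf]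
  exact congrArg _ (tprod_congr fun n => by ring)

lemma norm_pow_lt_one {q : ℂ} (hq : ‖q‖ < 1) {m : ℕ} (hm : m ≠ 0) : ‖q ^ m‖ < 1 := by
  rw [norm_pow]; exact pow_lt_one₀ (norm_nonneg _) hq hm

lemma f_eq_pochInf (m : ℕ) (q : ℂ) : f m q = pochInf (-q ^ m) (q ^ m) :=
  tprod_congr fun n => by ring

lemma f_pow (m k : ℕ) (q : ℂ) : f m (q ^ k) = f (k * m) q :=
  tprod_congr fun n => by ring

lemma f_ne_zero {m : ℕ} (hm : m ≠ 0) {q : ℂ} (hq : ‖q‖ < 1) : f m q ≠ 0 := by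
  rw [f_eq_pochInf]
  exact pochInf_ne_zero_of_norm_lt_one (norm_pow_lt_one hq hm)
    (by rw [norm_neg]; exact norm_pow_lt_one hq hm)

/-- `(-q;q)_∞ = f_2 / f_1`. -/
lemma pochInf_self {q : ℂ} (hq : ‖q‖ < 1) : pochInf q q = f 2 q / f 1 q := by
  rw [eq_div_iff (f_ne_zero one_ne_zero hq), f_eq_pochInf, f_eq_pochInf, pow_one,
    pochInf_mul_pochInf_neg _ hq]

/-- `(q;q²)_∞ = f_1 / f_2`. -/
lemma pochInf_neg_sq {q : ℂ} (hq : ‖q‖ < 1) : pochInf (-q) (q ^ 2) = f 1 q / f 2 q := by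
  rw [eq_div_iff (f_ne_zero two_ne_zero hq), f_eq_pochInf, f_eq_pochInf, pow_one,
    pochInf_eq_prod (-q) hq 2, Fin.prod_univ_two]
  simp only [Fin.val_zero, Fin.val_one, pow_zero, mul_one, pow_one]
  ring_nf

/-- `(-q;q²)_∞ = f_2² / (f_1 f_4)`. -/
lemma pochInf_sq {q : ℂ} (hq : ‖q‖ < 1) :
    pochInf q (q ^ 2) = f 2 q ^ 2 / (f 1 q * f 4 q) := by
  have h1 := f_ne_zero one_ne_zero hq
  have h2 := f_ne_zero two_ne_zero hq
  have h4 := f_ne_zero four_ne_zero hq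
  have hq2 := norm_pow_lt_one hq two_ne_zero
  have h := pochInf_mul_pochInf_neg q hq2
  rw [pochInf_neg_sq hq, pochInf_neg_sq hq2, f_pow, f_pow] at h
  norm_num at h
  field_simp at h ⊢
  exact h

lemma f_one_neg {q : ℂ} (hq : ‖q‖ < 1) : f 1 (-q) = f 2 q ^ 3 / (f 1 q * f 4 q) := by
  have hq' : ‖-q‖ < 1 := by rwa [norm_neg]
  have h := pochInf_neg_sq hq'
  have h2 : f 2 (-q) = f 2 q := by simp [f, pow_mul]
  rw [eq_div_iff (f_ne_zero two_ne_zero hq'), h2, neg_neg, neg_sq, pochInf_sq hq] at h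
  rw [← h]; ring

lemma f_even_neg (m : ℕ) (q : ℂ) : f (2 * m) (-q) = f (2 * m) q := by
  simp [f, pow_mul]

lemma f_neg_odd_pow {q : ℂ} (hq : ‖q‖ < 1) {m : ℕ} (hm : Odd m) :
    f m (-q) = f (2 * m) q ^ 3 / (f m q * f (4 * m) q) := by
  have h := f_one_neg (norm_pow_lt_one hq hm.pos.ne')
  rw [← hm.neg_pow, f_pow, f_pow, f_pow, f_pow] at h
  simpa [mul_comm] using h

/-- Serves to fix a sign by connectedness of the disc in `psi_phi_sub`. -/
lemma continuousOn_f {m : ℕ} (hm : m ≠ 0) : ContinuousOn (f m) (Metric.ball 0 1) := by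
  have h : f m = (fun q => ∏' n : ℕ, (1 - q ^ (n + 1))) ∘ fun q => q ^ m := by
    ext q; simp [f, pow_mul]
  rw [h]
  refine ModularForm.differentiableOn_tprod_one_sub_pow.continuousOn.comp (by fun_prop) ?_
  intro q hq
  simpa using pow_lt_one₀ (norm_nonneg q) (by simpa using hq) hm

lemma f_zero_right {m : ℕ} (hm : m ≠ 0) : f m 0 = 1 := by
  simp [f, hm]

/-! ### Theta series and Jacobi's triple product -/

open Filter Topology

/-- The triangular number `n(n-1)/2`. -/
def tri (n : ℤ) : ℤ := n * (n - 1) / 2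

lemma two_mul_tri (n : ℤ) : 2 * tri n = n * (n - 1) := by
  refine Int.mul_ediv_cancel' ?_
  rcases Int.even_or_odd n with h | h
  · exact h.two_dvd.mul_right _
  · exact (h.sub_odd odd_one).two_dvd.mul_left _

lemma tri_zero : tri 0 = 0 := rfl

lemma tri_add_one (n : ℤ) : tri (n + 1) = tri n + n := by
  have h1 := two_mul_tri (n + 1)
  have h2 := two_mul_tri n
  linarith

lemma summable_of_ratio_eq_geometric {u : ℕ → ℂ} {c q : ℂ} (hq : ‖q‖ < 1)
    (h : ∀ n, u (n + 1) = c * q ^ n * u n) : Summable u := by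
  have hlim : Tendsto (fun n : ℕ => ‖c * q ^ n‖) atTop (𝓝 0) := by
    simpa using ((tendsto_pow_atTop_nhds_zero_of_norm_lt_one hq).const_mul c).norm
  refine summable_of_ratio_norm_eventually_le (r := 1 / 2) (by norm_num) ?_
  filter_upwards [hlim.eventually_le_const (show (0 : ℝ) < 1 / 2 by norm_num)] with n hn
  rw [h, norm_mul]
  gcongr

/-- In both directions the ratio of consecutive terms is a constant times q^n, so the ratio test
applies to each half. -/
lemma summable_theta {z q : ℂ} (hz : z ≠ 0) (hq0 : q ≠ 0) (hq : ‖q‖ < 1) :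
    Summable fun n : ℤ => z ^ n * q ^ tri n := by
  refine Summable.of_nat_of_neg_add_one ?_ ?_
  · refine summable_of_ratio_eq_geometric (c := z) hq fun n => ?_
    push_cast
    rw [tri_add_one, zpow_add₀ hz, zpow_add₀ hq0, zpow_one, zpow_natCast, zpow_natCast]
    ring
  · refine summable_of_ratio_eq_geometric (c := z⁻¹ * q ^ 2) hq fun n => ?_
    have h := tri_add_one (-((n : ℤ) + 1 + 1))
    rw [show -((n : ℤ) + 1 + 1) + 1 = -(n + 1) by ring] at h
    push_cast
    rw [show tri (-((n : ℤ) + 1 + 1)) = tri (-(n + 1)) + n + 2 by linarith,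
      show -((n : ℤ) + 1 + 1) = -(n + 1) + -1 by ring, zpow_add₀ hz, zpow_add₀ hq0, zpow_add₀ hq0,
      zpow_neg_one, zpow_natCast, zpow_ofNat]
    ring

/-- The theta series `∑ zⁿ q^{n(n-1)/2}` over all integers. -/
noncomputable def theta (z q : ℂ) : ℂ := ∑' n : ℤ, z ^ n * q ^ tri n

/-- The finite product `(1 - q)(1 - q²) ⋯ (1 - qⁿ)`. -/
noncomputable def qFac (q : ℂ) (n : ℕ) : ℂ := ∏ i ∈ Finset.range n, (1 - q ^ (i + 1))

/-- The reciprocal of `qFac`, extended by zero to negative arguments. -/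
noncomputable def invQFac (q : ℂ) (n : ℤ) : ℂ := if 0 ≤ n then (qFac q n.toNat)⁻¹ else 0

lemma one_sub_pow_ne_zero {q : ℂ} (hq : ‖q‖ < 1) (n : ℕ) : 1 - q ^ (n + 1) ≠ 0 := by
  intro h
  have h1 := norm_pow_lt_one hq n.succ_ne_zero
  rw [Nat.succ_eq_add_one, ← sub_eq_zero.mp h] at h1
  simp at h1

lemma qFac_ne_zero {q : ℂ} (hq : ‖q‖ < 1) (n : ℕ) : qFac q n ≠ 0 :=
  Finset.prod_ne_zero_iff.mpr fun i _ => one_sub_pow_ne_zero hq i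

lemma qFac_succ (q : ℂ) (n : ℕ) : qFac q (n + 1) = qFac q n * (1 - q ^ (n + 1)) :=
  Finset.prod_range_succ _ _

/-- At n = 0 the vanishing factor 1 - q⁰ matches the extension by zero; hence the recurrences below
have no boundary cases. -/
lemma invQFac_sub_one {q : ℂ} (hq : ‖q‖ < 1) (n : ℤ) :
    invQFac q (n - 1) = (1 - q ^ n) * invQFac q n := by
  rcases lt_trichotomy n 0 with h | rfl | h
  · rw [invQFac, invQFac, if_neg (by lia), if_neg (by lia), mul_zero]
  · simp [invQFac]
  · obtain ⟨k, rfl⟩ : ∃ k : ℕ, n = k + 1 := ⟨(n - 1).toNat, by lia⟩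
    rw [invQFac, invQFac, if_pos (by lia), if_pos (by lia), add_sub_cancel_right,
      Int.toNat_natCast, show ((k : ℤ) + 1).toNat = k + 1 by lia, qFac_succ]
    have h1 := qFac_ne_zero hq k
    have h2 := one_sub_pow_ne_zero hq k
    have h3 : q ^ ((k : ℤ) + 1) = q ^ (k + 1) := by exact_mod_cast zpow_natCast q (k + 1)
    rw [h3]
    field_simp

/-- The coefficients of the finite form of the triple product identity. -/
noncomputable def tripleCoeff (q : ℂ) (a b : ℕ) (m : ℤ) : ℂ :=
  qFac q (a + b) * invQFac q (a - m) * invQFac q (b + m)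

/-- A q-Pascal rule: the effect on coefficients of z^m of multiplying the finite product by 1 + z
q^a. -/
lemma tripleCoeff_succ_left {q : ℂ} (hq0 : q ≠ 0) (hq : ‖q‖ < 1) (a b : ℕ) (m : ℤ) :
    tripleCoeff q (a + 1) b m * q ^ tri m =
      tripleCoeff q a b m * q ^ tri m + q ^ a * (tripleCoeff q a b (m - 1) * q ^ tri (m - 1)) := by
  have h1 := invQFac_sub_one hq (a + 1 - m)
  have h2 := invQFac_sub_one hq (b + m)
  have h3 := tri_add_one (m - 1)
  rw [show (a : ℤ) + 1 - m - 1 = a - m by ring] at h1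
  rw [show (b : ℤ) + m - 1 = b + (m - 1) by ring] at h2
  rw [sub_add_cancel] at h3
  simp only [tripleCoeff]
  rw [h2, h1, h3, show a + 1 + b = a + b + 1 by ring, qFac_succ]
  push_cast
  rw [show (a : ℤ) - (m - 1) = a + 1 - m by ring]
  simp only [zpow_add₀ hq0, zpow_sub₀ hq0, zpow_natCast, pow_add, zpow_one, pow_one]
  field_simp
  ring

lemma tripleCoeff_succ_right {q : ℂ} (hq0 : q ≠ 0) (hq : ‖q‖ < 1) (a b : ℕ) (m : ℤ) :
    tripleCoeff q a (b + 1) m * q ^ tri m = tripleCoeff q a b m * q ^ tri m +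
      q ^ (b + 1) * (tripleCoeff q a b (m + 1) * q ^ tri (m + 1)) := by
  have h1 := invQFac_sub_one hq (a - m)
  have h2 := invQFac_sub_one hq (b + 1 + m)
  rw [show (a : ℤ) - m - 1 = a - (m + 1) by ring] at h1
  rw [show (b : ℤ) + 1 + m - 1 = b + m by ring] at h2
  simp only [tripleCoeff]
  rw [h2, h1, tri_add_one, ← add_assoc a b, qFac_succ]
  push_cast
  rw [show (b : ℤ) + (m + 1) = b + 1 + m by ring]
  simp only [zpow_add₀ hq0, zpow_sub₀ hq0, zpow_natCast, pow_add, zpow_one, pow_one]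
  field_simp
  ring

/-- Induction on the two numbers of factors; each new factor adds a shifted copy of the series,
which the q-Pascal rules absorb. -/
lemma hasSum_finite_triple {z q : ℂ} (hz : z ≠ 0) (hq0 : q ≠ 0) (hq : ‖q‖ < 1) (a b : ℕ) :
    HasSum (fun m : ℤ => tripleCoeff q a b m * q ^ tri m * z ^ m)
      ((∏ i ∈ Finset.range a, (1 + z * q ^ i)) *
        ∏ i ∈ Finset.range b, (1 + z⁻¹ * q * q ^ i)) := by
  induction b with
  | zero =>
    induction a with
    | zero =>
      convert hasSum_single (0 : ℤ) fun m hm => ?_ using 1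
      · simp [tripleCoeff, invQFac, qFac, tri_zero]
      · rcases lt_or_gt_of_ne hm with h | h
        · simp [tripleCoeff, invQFac, not_le.mpr h]
        · simp [tripleCoeff, invQFac, not_le.mpr h]
    | succ a ih =>
      have h := ih.add (((Equiv.subRight (1 : ℤ)).hasSum_iff.mpr ih).mul_left (z * q ^ a))
      convert h using 1
      · ext m
        rw [tripleCoeff_succ_left hq0 hq]
        simp only [Function.comp, Equiv.subRight_apply, zpow_sub₀ hz, zpow_one]
        field_simp
      · rw [Finset.prod_range_succ]; ring
  | succ b ih =>
    have h := ih.add (((Equiv.addRight (1 : ℤ)).hasSum_iff.mpr ih).mul_left (z⁻¹ * q * q ^ b))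
    convert h using 1
    · ext m
      rw [tripleCoeff_succ_right hq0 hq]
      simp only [Function.comp, Equiv.coe_addRight, zpow_add₀ hz, zpow_one]
      field_simp
      ring
    · rw [Finset.prod_range_succ _ b]; ring

lemma tendsto_qFac {q : ℂ} (hq : ‖q‖ < 1) : Tendsto (qFac q) atTop (𝓝 (f 1 q)) := by
  have h := (ModularForm.multipliable_one_sub_pow hq).tendsto_prod_tprod_nat
  simp only [f, one_mul]
  exact h

lemma exists_norm_invQFac_le {q : ℂ} (hq : ‖q‖ < 1) : ∃ C : ℝ, ∀ n : ℤ, ‖invQFac q n‖ ≤ C := by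
  have h := ((tendsto_qFac hq).inv₀ (f_ne_zero one_ne_zero hq)).norm.bddAbove_range
  obtain ⟨C, hC⟩ := h
  have hC' : ∀ n : ℕ, ‖(qFac q n)⁻¹‖ ≤ C := fun n => hC ⟨n, rfl⟩
  refine ⟨C, fun n => ?_⟩
  rw [invQFac]
  split_ifs
  · exact hC' _
  · simpa using (norm_nonneg _).trans (hC' 0)

lemma tendsto_invQFac {q : ℂ} (hq : ‖q‖ < 1) : Tendsto (invQFac q) atTop (𝓝 (f 1 q)⁻¹) := by
  have h0 : Tendsto Int.toNat atTop atTop :=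
    tendsto_atTop_atTop.mpr fun b => ⟨b, fun a h => by lia⟩
  have h1 := ((tendsto_qFac hq).inv₀ (f_ne_zero one_ne_zero hq)).comp h0
  refine h1.congr' ?_
  filter_upwards [eventually_ge_atTop 0] with n hn
  simp [invQFac, hn]

lemma tendsto_tripleCoeff {q : ℂ} (hq : ‖q‖ < 1) (m : ℤ) :
    Tendsto (fun n : ℕ => tripleCoeff q n n m) atTop (𝓝 (f 1 q)⁻¹) := by
  have h0 := f_ne_zero one_ne_zero hq
  have hn : Tendsto (fun n : ℕ => (n : ℤ)) atTop atTop := tendsto_natCast_atTop_atTop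
  have h1 : Tendsto (fun n : ℕ => qFac q (n + n)) atTop (𝓝 (f 1 q)) :=
    (tendsto_qFac hq).comp (tendsto_atTop_mono (fun n => Nat.le_add_left n n) tendsto_id)
  have h2 := (tendsto_invQFac hq).comp (tendsto_atTop_add_const_right _ (-m) hn)
  have h3 := (tendsto_invQFac hq).comp (tendsto_atTop_add_const_right _ m hn)
  have h := (h1.mul h2).mul h3
  rw [mul_inv_cancel₀ h0, one_mul] at h
  exact h

/-- **Jacobi's triple product identity.** -/
theorem theta_eq_pochInf {z q : ℂ} (hz : z ≠ 0) (hq0 : q ≠ 0) (hq : ‖q‖ < 1) :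
    theta z q = f 1 q * pochInf z q * pochInf (z⁻¹ * q) q := by
  obtain ⟨C, hC⟩ := exists_norm_invQFac_le hq
  obtain ⟨D, hD⟩ := (tendsto_qFac hq).norm.bddAbove_range
  have hD' : ∀ n : ℕ, ‖qFac q n‖ ≤ D := fun n => hD ⟨n, rfl⟩
  have hC0 : 0 ≤ C := (norm_nonneg _).trans (hC 0)
  have hD0 : 0 ≤ D := (norm_nonneg _).trans (hD' 0)
  -- The finite identity is taken with a = b = n. Its coefficients tend to 1/f_1 and are bounded
  -- uniformly in n and m, so the theta series dominates.
  have hlim : Tendsto (fun n : ℕ => ∑' m : ℤ, tripleCoeff q n n m * q ^ tri m * z ^ m) atTop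
      (𝓝 (∑' m : ℤ, (f 1 q)⁻¹ * (z ^ m * q ^ tri m))) := by
    refine tendsto_tsum_of_dominated_convergence
      (bound := fun m : ℤ => D * C * C * ‖z ^ m * q ^ tri m‖)
      ((summable_theta hz hq0 hq).norm.mul_left _) (fun m => ?_)
      (Eventually.of_forall fun n m => ?_)
    · have h := (tendsto_tripleCoeff hq m).mul_const (z ^ m * q ^ tri m)
      refine h.congr fun n => by ring
    · rw [mul_assoc, norm_mul, mul_comm (q ^ tri m), tripleCoeff, norm_mul, norm_mul]
      gcongr
      · exact hD' _
      · exact hC _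
      · exact hC _
  have hlim2 := (multipliable_pochInf z hq).tendsto_prod_tprod_nat.mul
    (multipliable_pochInf (z⁻¹ * q) hq).tendsto_prod_tprod_nat
  simp only [(hasSum_finite_triple hz hq0 hq _ _).tsum_eq] at hlim
  have h := tendsto_nhds_unique hlim hlim2
  rw [tsum_mul_left, inv_mul_eq_iff_eq_mul₀ (f_ne_zero one_ne_zero hq)] at h
  rw [theta, h, pochInf, pochInf]
  ring

lemma theta_mul_self {z q : ℂ} (hz : z ≠ 0) (hq0 : q ≠ 0) :
    z * theta (z * q) q = theta z q := by
  rw [theta, theta, ← tsum_mul_left, 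
    ← (Equiv.addRight (1 : ℤ)).tsum_eq fun n : ℤ => z ^ n * q ^ tri n]
  refine tsum_congr fun n => ?_
  simp only [Equiv.coe_addRight, tri_add_one, zpow_add₀ hz, zpow_add₀ hq0, mul_zpow, zpow_one]
  ring

lemma theta_inv_mul_self {z q : ℂ} (hz : z ≠ 0) (hq0 : q ≠ 0) :
    theta (z⁻¹ * q) q = theta z q := by
  rw [theta, theta, ← (Equiv.neg ℤ).tsum_eq]
  refine tsum_congr fun n => ?_
  have h : tri (-n) = tri n + n := by
    have h1 := two_mul_tri n
    have h2 := two_mul_tri (-n)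
    linarith
  rw [Equiv.neg_apply, h, zpow_add₀ hq0, mul_zpow, inv_zpow, zpow_neg, zpow_neg, inv_inv]
  have := zpow_ne_zero n hq0
  field_simp

/-! ### Theta series at powers of q and lattice sums -/

section pow

variable {q : ℂ}

lemma theta_pow_add (hq0 : q ≠ 0) (j k : ℕ) :
    q ^ j * theta (q ^ (j + k)) (q ^ k) = theta (q ^ j) (q ^ k) := by
  rw [pow_add, theta_mul_self (pow_ne_zero _ hq0) (pow_ne_zero _ hq0)]

lemma theta_pow_reflect (hq0 : q ≠ 0) (i j : ℕ) :
    theta (q ^ i) (q ^ (i + j)) = theta (q ^ j) (q ^ (i + j)) := by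
  rw [← theta_inv_mul_self (pow_ne_zero i hq0) (pow_ne_zero _ hq0), pow_add,
    inv_mul_cancel_left₀ (pow_ne_zero i hq0)]

lemma hasSum_theta_pow (hq0 : q ≠ 0) (hq : ‖q‖ < 1) {k : ℕ} (hk : k ≠ 0) (i e : ℕ) :
    HasSum (fun n : ℤ => q ^ (k * tri n + i * n + e)) (q ^ e * theta (q ^ i) (q ^ k)) := by
  have h := (summable_theta (pow_ne_zero i hq0) (pow_ne_zero k hq0)
    (norm_pow_lt_one hq hk)).hasSum.mul_left (q ^ e)
  refine HasSum.congr_fun h fun n => ?_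
  rw [zpow_add₀ hq0, zpow_add₀ hq0, zpow_mul, zpow_mul, zpow_natCast, zpow_natCast, zpow_natCast]
  ring

lemma hasSum_theta_pow_mul (hq0 : q ≠ 0) (hq : ‖q‖ < 1) {k : ℕ} (hk : k ≠ 0) (i j e : ℕ) :
    HasSum (fun p : ℤ × ℤ => q ^ (k * tri p.1 + i * p.1 + (k * tri p.2 + j * p.2) + e))
      (q ^ e * (theta (q ^ i) (q ^ k) * theta (q ^ j) (q ^ k))) := by
  have h1 := hasSum_theta_pow hq0 hq hk i 0
  have h2 := hasSum_theta_pow hq0 hq hk j 0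
  have h12 := summable_mul_of_summable_norm h1.summable.norm h2.summable.norm
  have h := (HasSum.mul h1 h2 h12).mul_left (q ^ e)
  simp only [Nat.cast_zero, add_zero, pow_zero, one_mul] at h
  refine HasSum.congr_fun h fun p => ?_
  rw [← zpow_natCast q e, ← zpow_add₀ hq0, ← zpow_add₀ hq0]
  ring_nf

end pow

/-- Splitting a sum over the integer lattice along multiplication by `2 + i`. -/
lemma hasSum_eq_sum_five {F : ℤ × ℤ → ℂ} {T : ℂ} {S : Fin 5 → ℂ} (hF : HasSum F T)
    (hS : ∀ s : Fin 5, HasSum (fun p : ℤ × ℤ => F (2 * p.1 + p.2 + (s : ℕ), p.1 - 2 * p.2)) (S s)) :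
    T = ∑ s, S s := by
  -- For x = 2a+b+s and y = a-2b one has x - 2y = 5b + s: division by 5 recovers b and s, and then a
  -- = y + 2b.
  let e : Fin 5 × (ℤ × ℤ) ≃ ℤ × ℤ :=
    { toFun := fun p => (2 * p.2.1 + p.2.2 + (p.1 : ℕ), p.2.1 - 2 * p.2.2)
      invFun := fun p => (⟨((p.1 - 2 * p.2) % 5).toNat, by lia⟩,
        (p.2 + 2 * ((p.1 - 2 * p.2) / 5), (p.1 - 2 * p.2) / 5))
      left_inv := by
        rintro ⟨⟨s, hs⟩, a, b⟩
        simp only [Prod.mk.injEq, Fin.mk.injEq]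
        lia
      right_inv := by
        rintro ⟨x, y⟩
        simp only [Prod.mk.injEq]
        lia }
  exact ((e.hasSum_iff.mpr hF).prod_fiberwise hS).unique (hasSum_fintype _)

/-- Splitting a sum over the integer lattice along multiplication by `1 + i`. -/
lemma hasSum_eq_sum_two {F : ℤ × ℤ → ℂ} {T : ℂ} {S : Fin 2 → ℂ} (hF : HasSum F T)
    (hS : ∀ s : Fin 2, HasSum (fun p : ℤ × ℤ => F (p.1 + p.2 + (s : ℕ), p.1 - p.2)) (S s)) :
    T = ∑ s, S s := by
  let e : Fin 2 × (ℤ × ℤ) ≃ ℤ × ℤ :=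
    { toFun := fun p => (p.2.1 + p.2.2 + (p.1 : ℕ), p.2.1 - p.2.2)
      invFun := fun p => (⟨((p.1 - p.2) % 2).toNat, by lia⟩,
        (p.2 + (p.1 - p.2) / 2, (p.1 - p.2) / 2))
      left_inv := by
        rintro ⟨⟨s, hs⟩, a, b⟩
        simp only [Prod.mk.injEq, Fin.mk.injEq]
        lia
      right_inv := by
        rintro ⟨x, y⟩
        simp only [Prod.mk.injEq]
        lia }
  exact ((e.hasSum_iff.mpr hF).prod_fiberwise hS).unique (hasSum_fintype _)

/-! ### The functions φ and ψ, their 2-dissections and their quintic identities -/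

/-- Ramanujan's theta function `φ(q) = ∑ q^{n²}`, as a product. -/
noncomputable def phi (q : ℂ) : ℂ := f 2 q ^ 5 / (f 1 q ^ 2 * f 4 q ^ 2)

/-- Ramanujan's theta function `ψ(q) = ∑_{n ≥ 0} q^{n(n+1)/2}`, as a product. -/
noncomputable def psi (q : ℂ) : ℂ := f 2 q ^ 2 / f 1 q

section identities

variable {q : ℂ}

lemma theta_self_sq (hq0 : q ≠ 0) (hq : ‖q‖ < 1) : theta q (q ^ 2) = phi q := by
  rw [theta_eq_pochInf hq0 (pow_ne_zero 2 hq0) (norm_pow_lt_one hq two_ne_zero),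
    show q⁻¹ * q ^ 2 = q by field_simp, pochInf_sq hq, f_pow, phi]
  have h1 := f_ne_zero one_ne_zero hq
  have h4 := f_ne_zero four_ne_zero hq
  norm_num
  field_simp

/-- The bilateral series meets every triangular number twice; on the product side this is the factor
1 + z at z = 1. -/
lemma theta_self (hq0 : q ≠ 0) (hq : ‖q‖ < 1) : theta q q = 2 * psi q := by
  rw [theta_eq_pochInf hq0 hq0 hq, inv_mul_cancel₀ hq0, pochInf_succ 1 hq, one_mul,
    pochInf_self hq, psi]
  have h1 := f_ne_zero one_ne_zero hq
  field_simp
  ring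

lemma theta_phi (hq0 : q ≠ 0) (hq : ‖q‖ < 1) {k : ℕ} (hk : k ≠ 0) :
    theta (q ^ k) (q ^ (2 * k)) = phi (q ^ k) := by
  rw [mul_comm, pow_mul, theta_self_sq (pow_ne_zero k hq0) (norm_pow_lt_one hq hk)]

lemma theta_psi (hq0 : q ≠ 0) (hq : ‖q‖ < 1) {k : ℕ} (hk : k ≠ 0) :
    theta (q ^ k) (q ^ k) = 2 * psi (q ^ k) :=
  theta_self (pow_ne_zero k hq0) (norm_pow_lt_one hq hk)

lemma hasSum_phi (hq0 : q ≠ 0) (hq : ‖q‖ < 1) : HasSum (fun n : ℤ => q ^ (n ^ 2)) (phi q) := by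
  have h := hasSum_theta_pow hq0 hq two_ne_zero 1 0
  rw [pow_zero, one_mul, pow_one, theta_self_sq hq0 hq] at h
  refine HasSum.congr_fun h fun n => ?_
  congr 1
  push_cast
  linarith [two_mul_tri n]

lemma hasSum_phi_sq (hq0 : q ≠ 0) (hq : ‖q‖ < 1) :
    HasSum (fun p : ℤ × ℤ => q ^ (p.1 ^ 2 + p.2 ^ 2)) (phi q ^ 2) := by
  have h := hasSum_phi hq0 hq
  have h2 := summable_mul_of_summable_norm h.summable.norm h.summable.norm
  rw [sq (phi q)]
  refine HasSum.congr_fun (HasSum.mul h h h2) fun p => ?_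
  rw [zpow_add₀ hq0]

lemma hasSum_psi_sq (hq0 : q ≠ 0) (hq : ‖q‖ < 1) :
    HasSum (fun p : ℤ × ℤ => q ^ (tri (p.1 + 1) + tri (p.2 + 1))) (4 * psi q ^ 2) := by
  have h := hasSum_theta_pow_mul hq0 hq one_ne_zero 1 1 0
  rw [pow_zero, one_mul, pow_one, theta_self hq0 hq] at h
  rw [show 4 * psi q ^ 2 = 2 * psi q * (2 * psi q) by ring]
  refine HasSum.congr_fun h fun p => ?_
  rw [tri_add_one, tri_add_one]
  congr 1
  push_cast
  ring

lemma phi_eq_even_add_odd (hq0 : q ≠ 0) (hq : ‖q‖ < 1) :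
    phi q = phi (q ^ 4) + 2 * q * psi (q ^ 8) := by
  have h := (((Equiv.prodComm _ _).trans
    (Int.divModEquiv 2).symm).hasSum_iff.mpr (hasSum_phi hq0 hq)).prod_fiberwise
    (g := fun s : Fin 2 => q ^ ((s : ℕ) ^ 2) * theta (q ^ (4 + 4 * (s : ℕ))) (q ^ 8)) fun s => by
      refine HasSum.congr_fun (hasSum_theta_pow hq0 hq (by norm_num) _ _) fun n => ?_
      simp only [Function.comp, Equiv.trans_apply, Equiv.prodComm_apply, Prod.swap_prod_mk,
        Int.divModEquiv_symm_apply]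
      congr 1
      push_cast
      linear_combination -4 * two_mul_tri n
  have h := (hasSum_fintype _).unique h
  rw [Fin.sum_univ_two] at h
  have h4 := theta_phi hq0 hq four_ne_zero
  have h8 := theta_psi hq0 hq (k := 8) (by norm_num)
  norm_num at h h4
  rw [← h, h4, h8]
  ring

/-- Multiplication by 1+i doubles the norm x²+y²; the two cosets of its image give the two terms. -/
lemma phi_sq_eq (hq0 : q ≠ 0) (hq : ‖q‖ < 1) :
    phi q ^ 2 = phi (q ^ 2) ^ 2 + 4 * q * psi (q ^ 4) ^ 2 := by
  have h := hasSum_eq_sum_two (hasSum_phi_sq hq0 hq) (S := fun s => q ^ ((s : ℕ) ^ 2) *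
    (theta (q ^ (2 + 2 * (s : ℕ))) (q ^ 4) * theta (q ^ (2 + 2 * (s : ℕ))) (q ^ 4))) fun s => by
      refine HasSum.congr_fun (hasSum_theta_pow_mul hq0 hq four_ne_zero _ _ _) fun p => ?_
      congr 1
      push_cast
      linear_combination -2 * two_mul_tri p.1 - 2 * two_mul_tri p.2
  rw [Fin.sum_univ_two] at h
  have h2 := theta_phi hq0 hq two_ne_zero
  have h4 := theta_psi hq0 hq four_ne_zero
  norm_num at h h2
  rw [h, h2, h4]
  ring

/-- Multiplication by 2+i multiplies the norm by 5, so the coset s = 0 contributes φ(q⁵)². The other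
four cosets contribute equally. -/
lemma phi_sq_sub_eq_theta (hq0 : q ≠ 0) (hq : ‖q‖ < 1) :
    phi q ^ 2 - phi (q ^ 5) ^ 2 = 4 * q * (theta (q ^ 1) (q ^ 10) * theta (q ^ 3) (q ^ 10)) := by
  have h := hasSum_eq_sum_five (hasSum_phi_sq hq0 hq) (S := fun s => q ^ ((s : ℕ) ^ 2) *
    (theta (q ^ (5 + 4 * (s : ℕ))) (q ^ 10) * theta (q ^ (5 + 2 * (s : ℕ))) (q ^ 10))) fun s => by
      refine HasSum.congr_fun (hasSum_theta_pow_mul hq0 hq (by norm_num) _ _ _) fun p => ?_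
      congr 1
      push_cast
      linear_combination -5 * two_mul_tri p.1 - 5 * two_mul_tri p.2
  simp only [Fin.sum_univ_five, Fin.coe_ofNat_eq_mod] at h
  norm_num at h
  have h5 := theta_phi hq0 hq (k := 5) (by norm_num)
  have e9 := theta_pow_reflect hq0 1 9
  have e7 := theta_pow_reflect hq0 3 7
  have e11 := theta_pow_add hq0 1 10
  have e13 := theta_pow_add hq0 3 10
  have e17 := theta_pow_add hq0 7 10
  have e21 := theta_pow_add hq0 11 10
  norm_num at h5 e9 e7 e11 e13 e17 e21
  rw [h, h5, pow_one]
  -- Quasi-periodicity and reflection of theta bring each of the four products to q θ(q) θ(q³) with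
  -- nome q¹⁰.
  linear_combination
    (-q * theta (q ^ 7) (q ^ 10)) * e9 - q * theta q (q ^ 10) * e7
      + q * theta (q ^ 9) (q ^ 10) * e13 - q * theta (q ^ 3) (q ^ 10) * e9
      + q ^ 2 * theta (q ^ 11) (q ^ 10) * e17 + q * theta (q ^ 7) (q ^ 10) * e11
      - q * theta q (q ^ 10) * e7
      + q ^ 2 * (q ^ 3 * theta (q ^ 13) (q ^ 10)) * e21
      + q ^ 2 * theta (q ^ 11) (q ^ 10) * e13 + q * theta (q ^ 3) (q ^ 10) * e11

/-- The two theta products run over the residues 1, 3, 7, 9 modulo 10: they form (-q;q²)_∞ without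
the factors with exponent divisible by 5. -/
lemma phi_sq_sub (hq0 : q ≠ 0) (hq : ‖q‖ < 1) :
    phi q ^ 2 - phi (q ^ 5) ^ 2 = 4 * q * (f 2 q ^ 2 * f 5 q * f 20 q / (f 1 q * f 4 q)) := by
  have hq10 := norm_pow_lt_one hq (m := 10) (by norm_num)
  have hq2 := norm_pow_lt_one hq two_ne_zero
  have hq5 := norm_pow_lt_one hq (m := 5) (by norm_num)
  have h1 := f_ne_zero one_ne_zero hq
  have h2 := f_ne_zero two_ne_zero hq
  have h4 := f_ne_zero four_ne_zero hq
  have h5 := f_ne_zero (m := 5) (by norm_num) hq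
  have h10 := f_ne_zero (m := 10) (by norm_num) hq
  have h20 := f_ne_zero (m := 20) (by norm_num) hq
  have e1 := pochInf_eq_prod q hq2 5
  have e5 := pochInf_sq hq5
  rw [Fin.prod_univ_five, pochInf_sq hq] at e1
  rw [f_pow, f_pow, f_pow] at e5
  simp only [Fin.coe_ofNat_eq_mod] at e1
  norm_num at e1 e5
  simp only [← pow_mul, ← pow_succ'] at e1 e5
  norm_num at e1 e5
  rw [phi_sq_sub_eq_theta hq0 hq, theta_eq_pochInf (pow_ne_zero _ hq0) (pow_ne_zero _ hq0) hq10,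
    theta_eq_pochInf (pow_ne_zero _ hq0) (pow_ne_zero _ hq0) hq10,
    show (q ^ 1)⁻¹ * q ^ 10 = q ^ 9 by field_simp, show (q ^ 3)⁻¹ * q ^ 10 = q ^ 7 by field_simp,
    f_pow, pow_one]
  norm_num
  rw [e5] at e1
  left
  rw [show f 2 q ^ 2 * f 5 q * f 20 q / (f 1 q * f 4 q) =
    f 5 q * f 20 q * (f 2 q ^ 2 / (f 1 q * f 4 q)) by ring, e1]
  field_simp

/-- The same splitting for triangular exponents. Completing the square moves the centre, so the
exceptional coset, which gives ψ(q⁵)², is now s = 3. -/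
lemma psi_sq_sub_eq_theta (hq0 : q ≠ 0) (hq : ‖q‖ < 1) :
    psi q ^ 2 - q * psi (q ^ 5) ^ 2 = theta (q ^ 1) (q ^ 5) * theta (q ^ 2) (q ^ 5) := by
  have h := hasSum_eq_sum_five (hasSum_psi_sq hq0 hq)
    (S := fun s => q ^ ((s : ℕ) * ((s : ℕ) + 1) / 2) *
    (theta (q ^ (4 + 2 * (s : ℕ))) (q ^ 5) * theta (q ^ (2 + (s : ℕ))) (q ^ 5))) fun s => by
      refine HasSum.congr_fun (hasSum_theta_pow_mul hq0 hq (by norm_num) _ _ _) fun p => ?_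
      have h1 := two_mul_tri (2 * p.1 + p.2 + (s : ℕ) + 1)
      have h2 := two_mul_tri (p.1 - 2 * p.2 + 1)
      have h3 := two_mul_tri p.1
      have h4 := two_mul_tri p.2
      have h5 : 2 * (((s : ℕ) * ((s : ℕ) + 1) / 2 : ℕ) : ℤ) = (s : ℕ) * ((s : ℕ) + 1) := by
        exact_mod_cast Nat.mul_div_cancel' (Nat.even_mul_succ_self _).two_dvd
      congr 1
      push_cast at h5 ⊢
      linarith
  simp only [Fin.sum_univ_five, Fin.coe_ofNat_eq_mod] at h
  norm_num at h
  have h5 := theta_psi hq0 hq (k := 5) (by norm_num)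
  have e4 := theta_pow_reflect hq0 1 4
  have e3 := theta_pow_reflect hq0 2 3
  have e6 := theta_pow_add hq0 1 5
  have e7 := theta_pow_add hq0 2 5
  have e8 := theta_pow_add hq0 3 5
  have e10 := theta_pow_add hq0 5 5
  have e12 := theta_pow_add hq0 7 5
  norm_num at h h5 e4 e3 e6 e7 e8 e10 e12
  rw [h5] at h e10
  rw [← e4, ← e3] at h
  rw [← e3] at e8
  rw [pow_one]
  generalize theta (q ^ 6) (q ^ 5) = t6 at *
  generalize theta (q ^ 7) (q ^ 5) = t7 at *
  generalize theta (q ^ 8) (q ^ 5) = t8 at *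
  generalize theta (q ^ 10) (q ^ 5) = t10 at *
  generalize theta (q ^ 12) (q ^ 5) = t12 at *
  generalize theta (q ^ 2) (q ^ 5) = t2 at *
  generalize theta q (q ^ 5) = t1 at *
  have s4 : q ^ 10 * (t12 * t6) = t1 * t2 := by
    linear_combination q ^ 3 * t6 * e12 + q * t6 * e7 + t2 * e6
  have s2 : q ^ 3 * (t8 * t1) = t1 * t2 := by
    linear_combination t1 * e8
  have s3 : q ^ 6 * (t10 * psi (q ^ 5)) = 2 * q * psi (q ^ 5) ^ 2 := by
    linear_combination q * psi (q ^ 5) * e10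
  linear_combination (1 / 4) * h + (1 / 4) * s4 + (1 / 4) * s2 + (1 / 4) * t2 * e6 + (1 / 2) * s3

/-- Here the theta products run over the nonzero residues modulo 5, that is, over (-q;q)_∞ divided
by (-q⁵;q⁵)_∞. -/
lemma psi_sq_sub (hq0 : q ≠ 0) (hq : ‖q‖ < 1) :
    psi q ^ 2 - q * psi (q ^ 5) ^ 2 = f 2 q * f 5 q ^ 3 / (f 1 q * f 10 q) := by
  have hq5 := norm_pow_lt_one hq (m := 5) (by norm_num)
  have h1 := f_ne_zero one_ne_zero hq
  have h5 := f_ne_zero (m := 5) (by norm_num) hq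
  have h10 := f_ne_zero (m := 10) (by norm_num) hq
  have e1 := pochInf_eq_prod q hq 5
  have e5 := pochInf_self hq5
  rw [Fin.prod_univ_five, pochInf_self hq] at e1
  rw [f_pow, f_pow] at e5
  simp only [Fin.coe_ofNat_eq_mod] at e1
  norm_num at e1 e5
  simp only [← pow_succ'] at e1
  norm_num at e1 e5
  rw [psi_sq_sub_eq_theta hq0 hq, theta_eq_pochInf (pow_ne_zero _ hq0) (pow_ne_zero _ hq0) hq5,
    theta_eq_pochInf (pow_ne_zero _ hq0) (pow_ne_zero _ hq0) hq5,
    show (q ^ 1)⁻¹ * q ^ 5 = q ^ 4 by field_simp, show (q ^ 2)⁻¹ * q ^ 5 = q ^ 3 by field_simp,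
    f_pow, pow_one]
  norm_num
  rw [e5] at e1
  rw [show f 2 q * f 5 q ^ 3 / (f 1 q * f 10 q) = f 5 q ^ 3 / f 10 q * (f 2 q / f 1 q) by ring,
    e1, ← sq]
  field_simp

end identities

/-! ### Identities of levels 10 and 20 -/

section levelTen

variable {q : ℂ}

lemma phi_neg (hq : ‖q‖ < 1) : phi (-q) = f 1 q ^ 2 / f 2 q := by
  have h1 := f_ne_zero one_ne_zero hq
  have h2 := f_ne_zero two_ne_zero hq
  have h4 := f_ne_zero four_ne_zero hq
  rw [phi, f_one_neg hq, show f 2 (-q) = f 2 q from f_even_neg 1 q,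
    show f 4 (-q) = f 4 q from f_even_neg 2 q]
  field_simp

lemma phi_mul_phi_neg (hq : ‖q‖ < 1) : phi q * phi (-q) = f 2 q ^ 4 / f 4 q ^ 2 := by
  have h1 := f_ne_zero one_ne_zero hq
  have h2 := f_ne_zero two_ne_zero hq
  have h4 := f_ne_zero four_ne_zero hq
  rw [phi_neg hq, phi]
  field_simp

lemma psi_sq (hq : ‖q‖ < 1) : psi q ^ 2 = phi q * psi (q ^ 2) := by
  have h1 := f_ne_zero one_ne_zero hq
  have h2 := f_ne_zero two_ne_zero hq
  have h4 := f_ne_zero four_ne_zero hq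
  rw [psi, psi, phi, f_pow, f_pow]
  norm_num
  field_simp

lemma levelTen_psi (hq0 : q ≠ 0) (hq : ‖q‖ < 1) :
    f 2 q ^ 4 / f 1 q ^ 2 - q * (f 10 q ^ 4 / f 5 q ^ 2) =
      f 2 q * f 5 q ^ 3 / (f 1 q * f 10 q) := by
  rw [← psi_sq_sub hq0 hq, psi, psi, f_pow, f_pow]
  ring

/-- This is `phi_sq_sub` at -q. -/
lemma levelTen_phi (hq0 : q ≠ 0) (hq : ‖q‖ < 1) :
    f 1 q ^ 4 / f 2 q ^ 2 - f 5 q ^ 4 / f 10 q ^ 2 =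
      -4 * q * (f 1 q * f 10 q ^ 3 / (f 2 q * f 5 q)) := by
  have hq' : ‖-q‖ < 1 := by rwa [norm_neg]
  have h1 := f_ne_zero one_ne_zero hq
  have h2 := f_ne_zero two_ne_zero hq
  have h4 := f_ne_zero four_ne_zero hq
  have h5 := f_ne_zero (m := 5) (by norm_num) hq
  have h10 := f_ne_zero (m := 10) (by norm_num) hq
  have h20 := f_ne_zero (m := 20) (by norm_num) hq
  have h := phi_sq_sub (neg_ne_zero.mpr hq0) hq'
  rw [Odd.neg_pow (show Odd 5 by decide), phi_neg hq,
    phi_neg (norm_pow_lt_one hq (m := 5) (by norm_num)), f_pow, f_pow, f_one_neg hq,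
    f_neg_odd_pow hq (show Odd 5 by decide),
    show f 2 (-q) = f 2 q from f_even_neg 1 q, show f 4 (-q) = f 4 q from f_even_neg 2 q,
    show f 20 (-q) = f 20 q from f_even_neg 10 q] at h
  norm_num at h
  simp only [div_pow, ← pow_mul] at h
  norm_num at h
  rw [h]
  field_simp

/-- A level 20 identity of weight two. -/
lemma psi_phi_sq_add (hq0 : q ≠ 0) (hq : ‖q‖ < 1) :
    psi (q ^ 2) ^ 2 * phi (q ^ 5) ^ 2 + q ^ 2 * phi q ^ 2 * psi (q ^ 10) ^ 2 =
      f 1 q ^ 2 * f 5 q ^ 2 + 2 * q * (f 2 q ^ 4 * f 10 q ^ 4 / (f 1 q ^ 2 * f 5 q ^ 2)) := by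
  have h1 := f_ne_zero one_ne_zero hq
  have h2 := f_ne_zero two_ne_zero hq
  have h4 := f_ne_zero four_ne_zero hq
  have h5 := f_ne_zero (m := 5) (by norm_num) hq
  have h10 := f_ne_zero (m := 10) (by norm_num) hq
  have h20 := f_ne_zero (m := 20) (by norm_num) hq
  have e1 := psi_sq hq
  have e2 := psi_sq (norm_pow_lt_one hq (m := 5) (by norm_num))
  have e3 := phi_sq_sub hq0 hq
  have e4 := psi_sq_sub (pow_ne_zero 2 hq0) (norm_pow_lt_one hq two_ne_zero)
  have r1 := levelTen_psi hq0 hq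
  have r2 := levelTen_phi hq0 hq
  rw [f_pow, f_pow, f_pow, f_pow, ← pow_mul] at e4
  rw [← pow_mul] at e2
  norm_num at e2 e4
  have e1' : f 2 q ^ 8 / f 1 q ^ 4 = phi q ^ 2 * psi (q ^ 2) ^ 2 := by
    rw [← mul_pow, ← e1, psi]; ring
  have e2' : f 10 q ^ 8 / f 5 q ^ 4 = phi (q ^ 5) ^ 2 * psi (q ^ 10) ^ 2 := by
    rw [← mul_pow, ← e2, psi, f_pow, f_pow]; ring
  -- Expanding (φ(q)² - φ(q⁵)²)(ψ(q²)² - q² ψ(q¹⁰)²) yields the mixed terms wanted, and the pure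
  -- ones are eta quotients because φ(q) ψ(q²) = ψ(q)².
  have e5 : psi (q ^ 2) ^ 2 * phi (q ^ 5) ^ 2 + q ^ 2 * phi q ^ 2 * psi (q ^ 10) ^ 2 =
      f 2 q ^ 8 / f 1 q ^ 4 + q ^ 2 * (f 10 q ^ 8 / f 5 q ^ 4) -
        (f 4 q * f 10 q ^ 3 / (f 2 q * f 20 q)) *
          (4 * q * (f 2 q ^ 2 * f 5 q * f 20 q / (f 1 q * f 4 q))) := by
    rw [e1', e2', ← e3, ← e4]; ring
  rw [e5]
  linear_combination (norm := skip) (f 2 q ^ 4 / f 1 q ^ 2 - q * (f 10 q ^ 4 / f 5 q ^ 2) +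
    f 2 q * f 5 q ^ 3 / (f 1 q * f 10 q)) * r1 - f 2 q ^ 2 * f 5 q ^ 2 / f 1 q ^ 2 * r2
  field_simp
  ring

lemma continuousOn_psi_phi_sub : ContinuousOn
    (fun q => psi (q ^ 2) * phi (q ^ 5) - q * phi q * psi (q ^ 10)) (Metric.ball 0 1) := by
  have hf : ∀ m : ℕ, m ≠ 0 → ∀ q ∈ Metric.ball (0 : ℂ) 1, f m q ≠ 0 := fun m hm q hq =>
    f_ne_zero hm (by simpa using hq)
  have hc : ∀ m : ℕ, m ≠ 0 → ContinuousOn (f m) (Metric.ball 0 1) := fun m hm => continuousOn_f hm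
  simp only [psi, phi, f_pow]
  refine ((((hc _ (by norm_num)).pow 2).div (hc _ (by norm_num)) fun q hq => ?_).mul
    (((hc _ (by norm_num)).pow 5).div (((hc _ (by norm_num)).pow 2).mul
      ((hc _ (by norm_num)).pow 2)) fun q hq => ?_)).sub
    ((continuousOn_id.mul (((hc _ (by norm_num)).pow 5).div (((hc _ (by norm_num)).pow 2).mul
      ((hc _ (by norm_num)).pow 2)) fun q hq => ?_)).mul
    (((hc _ (by norm_num)).pow 2).div (hc _ (by norm_num)) fun q hq => ?_))
  · exact hf _ (by norm_num) q hq
  · exact mul_ne_zero (pow_ne_zero _ (hf _ (by norm_num) q hq))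
      (pow_ne_zero _ (hf _ (by norm_num) q hq))
  · exact mul_ne_zero (pow_ne_zero _ (hf _ (by norm_num) q hq))
      (pow_ne_zero _ (hf _ (by norm_num) q hq))
  · exact hf _ (by norm_num) q hq

/-- With X and Y the two terms, `psi_phi_sq_add` gives X² + Y², and XY = q ψ(q)² ψ(q⁵)² removes the
surplus, so (X - Y)² = (f_1 f_5)². As f_1 f_5 has no zero in the connected disc, the sign is
constant; both sides are 1 at q = 0. -/
lemma psi_phi_sub (hq : ‖q‖ < 1) :
    psi (q ^ 2) * phi (q ^ 5) - q * phi q * psi (q ^ 10) = f 1 q * f 5 q := by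
  have h0 : psi ((0 : ℂ) ^ 2) * phi (0 ^ 5) - 0 * phi 0 * psi (0 ^ 10) = 1 := by
    simp [psi, phi, f_zero_right]
  have hsq : Set.EqOn ((fun q => psi (q ^ 2) * phi (q ^ 5) - q * phi q * psi (q ^ 10)) ^ 2)
      ((fun q => f 1 q * f 5 q) ^ 2) (Metric.ball 0 1) := by
    intro q hq
    have hq1 : ‖q‖ < 1 := by simpa using hq
    rcases eq_or_ne q 0 with rfl | hq0
    · simp only [Pi.pow_apply]
      rw [h0]
      simp [f_zero_right]
    · have h1 := f_ne_zero one_ne_zero hq1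
      have h5 := f_ne_zero (m := 5) (by norm_num) hq1
      have e := psi_phi_sq_add hq0 hq1
      have e1 := psi_sq hq1
      have e2 := psi_sq (norm_pow_lt_one hq1 (m := 5) (by norm_num))
      rw [← pow_mul] at e2
      norm_num at e2
      have e3 : f 2 q ^ 4 * f 10 q ^ 4 / (f 1 q ^ 2 * f 5 q ^ 2) =
          (phi q * psi (q ^ 2)) * (phi (q ^ 5) * psi (q ^ 10)) := by
        rw [← e1, ← e2, psi, psi, f_pow, f_pow]
        ring
      simp only [Pi.pow_apply]
      rw [e3] at e
      linear_combination e
  have hne : ∀ {q : ℂ}, q ∈ Metric.ball (0 : ℂ) 1 → f 1 q * f 5 q ≠ 0 := fun {q} hq =>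
    mul_ne_zero (f_ne_zero one_ne_zero (by simpa using hq))
      (f_ne_zero (by norm_num) (by simpa using hq))
  have hpre : IsPreconnected (Metric.ball (0 : ℂ) 1) := (convex_ball 0 1).isPreconnected
  rcases hpre.eq_or_eq_neg_of_sq_eq continuousOn_psi_phi_sub
    ((continuousOn_f one_ne_zero).mul (continuousOn_f (m := 5) (by norm_num))) hsq hne with h | h
  · exact h (by simpa using hq)
  · have h' := h (Metric.mem_ball_self one_pos)
    simp only [Pi.neg_apply] at h'
    rw [h0] at h'
    norm_num [f_zero_right] at h'

end levelTen

/-! ### The operator U₂ on the cusp form and on the generating function of core pairs -/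

/-- `q f_1⁴ f_5⁴`, the `q`-expansion of the cusp form `η(τ)⁴ η(5τ)⁴`. -/
noncomputable def cusp (q : ℂ) : ℂ := q * f 1 q ^ 4 * f 5 q ^ 4

/-- `q² f_5¹⁰ / f_1²`, the shifted generating function of pairs of `5`-cores. -/
noncomputable def corePairGF (q : ℂ) : ℂ := q ^ 2 * (f 5 q ^ 10 / f 1 q ^ 2)

section evenParts

variable {w : ℂ}

lemma phi_neg_sq_eq (hw0 : w ≠ 0) (hw : ‖w‖ < 1) :
    phi (-w) ^ 2 = phi (w ^ 2) ^ 2 - 4 * w * psi (w ^ 4) ^ 2 := by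
  rw [phi_sq_eq (neg_ne_zero.mpr hw0) (by rwa [norm_neg]), Even.neg_pow (by decide),
    Even.neg_pow (by decide)]
  ring

lemma f_sq_eq_phi_neg (hw : ‖w‖ < 1) : f 1 w ^ 2 = phi (-w) * f 2 w := by
  rw [phi_neg hw, div_mul_cancel₀ _ (f_ne_zero two_ne_zero hw)]

lemma f_five_sq_eq_phi_neg (hw : ‖w‖ < 1) : f 5 w ^ 2 = phi (-w ^ 5) * f 10 w := by
  have h := f_sq_eq_phi_neg (norm_pow_lt_one hw (m := 5) (by norm_num))
  rwa [f_pow, f_pow] at h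

/-- Since f_1² = φ(-w) f_2, the form is w φ(-w)² φ(-w⁵)² times an even function. Inserting the
2-dissections of the squares, the surviving terms are the left side of `psi_phi_sq_add` at w². -/
lemma cusp_even_part (hw0 : w ≠ 0) (hw : ‖w‖ < 1) :
    (cusp w + cusp (-w)) / 2 = -4 * cusp (w ^ 2) - 8 * cusp (w ^ 4) := by
  have hw' : ‖-w‖ < 1 := by rwa [norm_neg]
  have hw5 : ‖w ^ 5‖ < 1 := norm_pow_lt_one hw (by norm_num)
  have hq : ‖w ^ 2‖ < 1 := norm_pow_lt_one hw two_ne_zero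
  have h1 := f_ne_zero one_ne_zero hq
  have h5 := f_ne_zero (m := 5) (by norm_num) hq
  have e := psi_phi_sq_add (pow_ne_zero 2 hw0) hq
  have p1 := phi_neg_sq_eq hw0 hw
  have p5 := phi_neg_sq_eq (pow_ne_zero 5 hw0) hw5
  have m1 := phi_sq_eq hw0 hw
  have m5 := phi_sq_eq (pow_ne_zero 5 hw0) hw5
  have a1 := f_sq_eq_phi_neg hw
  have a5 := f_five_sq_eq_phi_neg hw
  have b1 := f_sq_eq_phi_neg hw'
  have b5 := f_five_sq_eq_phi_neg hw'
  rw [neg_neg, show f 2 (-w) = f 2 w from f_even_neg 1 w] at b1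
  rw [Odd.neg_pow (by decide), neg_neg, show f 10 (-w) = f 10 w from f_even_neg 5 w] at b5
  have g1 : f 1 (w ^ 2) = f 2 w := f_pow 1 2 w
  have g2 : f 2 (w ^ 2) = f 1 (w ^ 4) := by rw [f_pow, f_pow]
  have g5 : f 5 (w ^ 2) = f 10 w := f_pow 5 2 w
  have g10 : f 10 (w ^ 2) = f 5 (w ^ 4) := by rw [f_pow, f_pow]
  simp only [← pow_mul] at e p5 m5
  norm_num at e p5 m5
  have c1 : cusp w = w * (phi (-w) ^ 2 * f 2 w ^ 2) * (phi (-w ^ 5) ^ 2 * f 10 w ^ 2) := by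
    rw [cusp, ← mul_pow, ← mul_pow, ← a1, ← a5]; ring
  have c2 : cusp (-w) = -w * (phi w ^ 2 * f 2 w ^ 2) * (phi (w ^ 5) ^ 2 * f 10 w ^ 2) := by
    rw [cusp, ← mul_pow, ← mul_pow, ← b1, ← b5]; ring
  rw [c1, c2, p1, p5, m1, m5, cusp, cusp, ← g2, ← g10, ← g1, ← g5]
  linear_combination (norm := skip) -4 * w ^ 2 * f 1 (w ^ 2) ^ 2 * f 5 (w ^ 2) ^ 2 * e
  field_simp
  ring

/-- Everything is a rational function of the level 10 Hauptmodul x, up to the common factor q²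
F5¹⁰/F1². The relations `r1` and `r2` say that two eta quotients equal 1 + x and 1 - 4x, and
together they express y through x. -/
lemma levelTen_weight_four {q F1 F2 F5 F10 : ℂ} (hq : q ≠ 0) (h1 : F1 ≠ 0) (h2 : F2 ≠ 0)
    (h5 : F5 ≠ 0) (h10 : F10 ≠ 0)
    (r1 : F2 ^ 4 / F1 ^ 2 - q * (F10 ^ 4 / F5 ^ 2) = F2 * F5 ^ 3 / (F1 * F10))
    (r2 : F1 ^ 4 / F2 ^ 2 - F5 ^ 4 / F10 ^ 2 = -4 * q * (F1 * F10 ^ 3 / (F2 * F5))) :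
    q * F5 ^ 5 * F2 ^ 2 / F1 ^ 5 *
      (((F1 ^ 2 * F5 ^ 2 + 2 * q * (F2 ^ 4 * F10 ^ 4 / (F1 ^ 2 * F5 ^ 2))) * (F5 ^ 8 / F10 ^ 4) -
        2 * q ^ 2 * (F10 ^ 8 / F5 ^ 4) *
          (F1 ^ 4 * F5 ^ 4 / (F2 * F10) ^ 2 + 8 * q * (F2 ^ 2 * F10 ^ 2))) / (F2 * F10) -
        16 * q ^ 3 * F2 * F10 * (F10 ^ 8 / F5 ^ 4)) =
    q * F1 ^ 4 * F5 ^ 4 + 9 * (q ^ 2 * (F5 ^ 10 / F1 ^ 2)) - 8 * (q ^ 4 * (F10 ^ 10 / F2 ^ 2)) := by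
  obtain ⟨x, hx⟩ : ∃ x, x = q * F1 * F10 ^ 5 / (F2 * F5 ^ 5) := ⟨_, rfl⟩
  obtain ⟨y, hy⟩ : ∃ y, y = q * F2 ^ 4 * F10 ^ 4 / (F1 ^ 4 * F5 ^ 4) := ⟨_, rfl⟩
  have hx0 : x ≠ 0 := by rw [hx]; positivity
  have hA : F2 ^ 3 * F10 / (F1 * F5 ^ 3) = 1 + x := by
    rw [hx]; field_simp at r1 ⊢; linear_combination r1
  have hB : F1 ^ 4 * F10 ^ 2 / (F2 ^ 2 * F5 ^ 4) = 1 - 4 * x := by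
    rw [hx]; field_simp at r2 ⊢; linear_combination r2
  have hxy : y * (1 - 4 * x) = x * (1 + x) := by
    rw [← hA, ← hB, hx, hy]; field_simp
  have hc : q * F1 ^ 4 * F5 ^ 4 = q ^ 2 * (F5 ^ 10 / F1 ^ 2) * ((1 - 4 * x) ^ 2 * (1 + x) / x) := by
    rw [← hA, ← hB, hx]; field_simp
  have hv : q ^ 4 * (F10 ^ 10 / F2 ^ 2) = q ^ 2 * (F5 ^ 10 / F1 ^ 2) * x ^ 2 := by
    rw [hx]; field_simp
  have hl : q * F5 ^ 5 * F2 ^ 2 / F1 ^ 5 *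
      (((F1 ^ 2 * F5 ^ 2 + 2 * q * (F2 ^ 4 * F10 ^ 4 / (F1 ^ 2 * F5 ^ 2))) * (F5 ^ 8 / F10 ^ 4) -
        2 * q ^ 2 * (F10 ^ 8 / F5 ^ 4) *
          (F1 ^ 4 * F5 ^ 4 / (F2 * F10) ^ 2 + 8 * q * (F2 ^ 2 * F10 ^ 2))) / (F2 * F10) -
        16 * q ^ 3 * F2 * F10 * (F10 ^ 8 / F5 ^ 4)) =
      q ^ 2 * (F5 ^ 10 / F1 ^ 2) * ((1 + 2 * y - 2 * x ^ 2 - 32 * x ^ 2 * y) / x) := by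
    rw [hx, hy]; field_simp; ring
  rw [hl, hc, hv]
  have : (1 + 2 * y - 2 * x ^ 2 - 32 * x ^ 2 * y) / x =
      (1 - 4 * x) ^ 2 * (1 + x) / x + 9 - 8 * x ^ 2 := by
    field_simp
    linear_combination (2 + 8 * x) * hxy
  rw [this]; ring

/-- The letters α ± β stand for φ(±w) and γ ± δ for φ(±w⁵), with β and δ odd in w. Then (α+β)(γ-δ) =
E + 2wG and (γ-δ)² = Q - 4w⁵s, so the even part can be read off. E is eliminated through E·G and E²,
leaving only a, b, d, e and G, which are eta quotients in w² when the lemma is applied. -/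
lemma even_part_eq {w α β γ δ P Q p s a b d e G : ℂ} (hw : w ≠ 0) (hG : G ≠ 0)
    (h1 : α ^ 2 + β ^ 2 = P) (h2 : α * β = 2 * w * p) (h3 : γ ^ 2 + δ ^ 2 = Q)
    (h4 : γ * δ = 2 * w ^ 5 * s) (h5 : β * γ - α * δ = 2 * w * G) (ha : P * p = a)
    (hb : Q * s = b) (hd : Q ^ 2 - 16 * w ^ 10 * s ^ 2 = d) (he : p * Q + w ^ 4 * P * s = e) :
    ((α + β) * (γ - δ) ^ 5 + (α - β) * (γ + δ) ^ 5) / 2 =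
      (e * d - 2 * w ^ 4 * b * ((e ^ 2 - 4 * w ^ 4 * a * b) / G ^ 2 + 4 * w ^ 2 * G ^ 2)) / G -
        16 * w ^ 6 * G * b := by
  obtain ⟨E, hE⟩ : ∃ E, E = α * γ - β * δ := ⟨_, rfl⟩
  have e1 : E * G = p * Q - w ^ 4 * s * P := by
    have : 2 * w * (E * G) = 2 * w * (p * Q - w ^ 4 * s * P) := by
      rw [hE, ← h1, ← h3]
      linear_combination (-(α * γ - β * δ)) * h5 + (γ ^ 2 + δ ^ 2) * h2 - (α ^ 2 + β ^ 2) * h4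
    exact mul_left_cancel₀ (mul_ne_zero two_ne_zero hw) this
  have e2 : E ^ 2 = P * Q - 16 * w ^ 6 * p * s - 4 * w ^ 2 * G ^ 2 := by
    rw [hE, ← h1, ← h3]
    linear_combination (-(β * γ - α * δ + 2 * w * G)) * h5 - 4 * γ * δ * h2 - 8 * w * p * h4
  have e3 : (α + β) * (γ - δ) = E + 2 * w * G := by rw [hE, ← h5]; ring
  have e4 : (α - β) * (γ + δ) = E - 2 * w * G := by rw [hE, ← h5]; ring
  have e5 : (γ - δ) ^ 2 = Q - 4 * w ^ 5 * s := by rw [← h3]; linear_combination -2 * h4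
  have e6 : (γ + δ) ^ 2 = Q + 4 * w ^ 5 * s := by rw [← h3]; linear_combination 2 * h4
  have e7 : ((α + β) * (γ - δ) ^ 5 + (α - β) * (γ + δ) ^ 5) / 2 =
      E * (Q ^ 2 + 16 * w ^ 10 * s ^ 2) - 16 * w ^ 6 * G * b := by
    rw [show (α + β) * (γ - δ) ^ 5 = (α + β) * (γ - δ) * ((γ - δ) ^ 2) ^ 2 by ring,
      show (α - β) * (γ + δ) ^ 5 = (α - β) * (γ + δ) * ((γ + δ) ^ 2) ^ 2 by ring,
      e3, e4, e5, e6, ← hb]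
    ring
  have e8 : (e ^ 2 - 4 * w ^ 4 * a * b) / G ^ 2 = E ^ 2 := by
    rw [div_eq_iff (pow_ne_zero 2 hG), ← mul_pow, e1, ← ha, ← hb, ← he]
    ring
  rw [e7, e8, e2, sub_left_inj, eq_div_iff hG]
  have e9 : E * (Q ^ 2 + 16 * w ^ 10 * s ^ 2) * G =
      (p * Q - w ^ 4 * s * P) * (Q ^ 2 + 16 * w ^ 10 * s ^ 2) := by rw [← e1]; ring
  rw [e9, ← hd, ← hb, ← he]
  ring

/-- Up to an even factor the function is φ(w) φ(-w⁵)⁵, to which `even_part_eq` applies. Its odd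
cross term βγ - αδ is evaluated by `psi_phi_sub` at w⁴, and `levelTen_weight_four` at w² finishes.
-/
lemma corePairGF_even_part (hw0 : w ≠ 0) (hw : ‖w‖ < 1) :
    (corePairGF w + corePairGF (-w)) / 2 =
      cusp (w ^ 2) + 9 * corePairGF (w ^ 2) - 8 * corePairGF (w ^ 4) := by
  have hw' : ‖-w‖ < 1 := by rwa [norm_neg]
  have hw5 : ‖w ^ 5‖ < 1 := norm_pow_lt_one hw (by norm_num)
  have hq : ‖w ^ 2‖ < 1 := norm_pow_lt_one hw two_ne_zero
  have hq0 : w ^ 2 ≠ 0 := pow_ne_zero 2 hw0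
  have hq4 : ‖w ^ 4‖ < 1 := norm_pow_lt_one hw four_ne_zero
  have h1 := f_ne_zero one_ne_zero hq
  have h2 := f_ne_zero two_ne_zero hq
  have h5 := f_ne_zero (m := 5) (by norm_num) hq
  have h10 := f_ne_zero (m := 10) (by norm_num) hq
  have key := levelTen_weight_four hq0 h1 h2 h5 h10 (levelTen_psi hq0 hq) (levelTen_phi hq0 hq)
  have e := psi_phi_sq_add hq0 hq
  have es := psi_phi_sub hq4
  have p1 := phi_neg_sq_eq hw0 hw
  have p5 := phi_neg_sq_eq (pow_ne_zero 5 hw0) hw5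
  have m1 := phi_sq_eq hw0 hw
  have m5 := phi_sq_eq (pow_ne_zero 5 hw0) hw5
  have s1 := phi_eq_even_add_odd hw0 hw
  have s2 := phi_eq_even_add_odd (neg_ne_zero.mpr hw0) hw'
  have s5 := phi_eq_even_add_odd (pow_ne_zero 5 hw0) hw5
  have s6 := phi_eq_even_add_odd (neg_ne_zero.mpr (pow_ne_zero 5 hw0))
    (by rw [norm_neg]; exact hw5)
  have u1 := psi_sq hq
  have u5 := psi_sq (norm_pow_lt_one hq (m := 5) (by norm_num))
  have n5 := phi_mul_phi_neg hw5
  have a5 := f_five_sq_eq_phi_neg hw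
  have b5 := f_five_sq_eq_phi_neg hw'
  have k2 : f 2 (-w) = f 2 w := f_even_neg 1 w
  have k4 : f 4 (-w) = f 4 w := f_even_neg 2 w
  rw [Odd.neg_pow (by decide), neg_neg, show f 10 (-w) = f 10 w from f_even_neg 5 w] at b5
  have g1 : f 1 (w ^ 2) = f 2 w := f_pow 1 2 w
  have g2 : f 2 (w ^ 2) = f 4 w := f_pow 2 2 w
  have g2' : f 1 (w ^ 4) = f 2 (w ^ 2) := by rw [f_pow, f_pow]
  have g5 : f 5 (w ^ 2) = f 10 w := f_pow 5 2 w
  have g10 : f 10 (w ^ 2) = f 5 (w ^ 4) := by rw [f_pow, f_pow]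
  have g10' : f 20 w = f 10 (w ^ 2) := (f_pow 10 2 w).symm
  have h2w := f_ne_zero two_ne_zero hw
  have h4w := f_ne_zero four_ne_zero hw
  have k1 : phi w = f 2 w ^ 5 / (f 1 w ^ 2 * f 4 w ^ 2) := rfl
  have k1' : phi (-w) = f 2 w ^ 5 / (f 1 (-w) ^ 2 * f 4 w ^ 2) := by rw [phi, k2, k4]
  have c1 : corePairGF w = w ^ 2 * f 5 (w ^ 2) ^ 5 * f 2 (w ^ 2) ^ 2 / f 1 (w ^ 2) ^ 5 *
      (phi w * phi (-w ^ 5) ^ 5) := by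
    rw [corePairGF, show f 5 w ^ 10 = (f 5 w ^ 2) ^ 5 by ring, a5, g1, g2, g5, k1]
    field_simp
  have c2 : corePairGF (-w) = w ^ 2 * f 5 (w ^ 2) ^ 5 * f 2 (w ^ 2) ^ 2 / f 1 (w ^ 2) ^ 5 *
      (phi (-w) * phi (w ^ 5) ^ 5) := by
    rw [corePairGF, show f 5 (-w) ^ 10 = (f 5 (-w) ^ 2) ^ 5 by ring, b5, g1, g2, g5, k1',
      neg_sq]
    field_simp
  rw [Even.neg_pow (by decide), Even.neg_pow (by decide)] at s2 s6
  have u5' : psi ((w ^ 2) ^ 5) = f 10 (w ^ 2) ^ 2 / f 5 (w ^ 2) := by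
    rw [psi, f_pow 2 5, f_pow 1 5]
  rw [u5'] at u5
  rw [f_pow, f_pow] at n5
  simp only [← pow_mul] at e es p5 m5 s5 s6 u1 u5
  norm_num at e es p5 m5 s5 s6 u1 u5 n5
  have v1 : psi (w ^ 2) ^ 4 = f 2 (w ^ 2) ^ 8 / f 1 (w ^ 2) ^ 4 := by rw [psi]; ring
  rw [← g5, g10'] at n5
  have key2 := even_part_eq (α := phi (w ^ 4)) (β := 2 * w * psi (w ^ 8)) (γ := phi (w ^ 20))
    (δ := 2 * w ^ 5 * psi (w ^ 40)) (P := phi (w ^ 2) ^ 2) (Q := phi (w ^ 10) ^ 2)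
    (p := psi (w ^ 4) ^ 2) (s := psi (w ^ 20) ^ 2) (a := f 2 (w ^ 2) ^ 8 / f 1 (w ^ 2) ^ 4)
    (b := f 10 (w ^ 2) ^ 8 / f 5 (w ^ 2) ^ 4) (d := f 5 (w ^ 2) ^ 8 / f 10 (w ^ 2) ^ 4)
    (G := f 2 (w ^ 2) * f 10 (w ^ 2)) hw0 (mul_ne_zero h2 h10) ?_ ?_ ?_ ?_ ?_ ?_ ?_ ?_ e
  · have hsum : phi w * phi (-w ^ 5) ^ 5 + phi (-w) * phi (w ^ 5) ^ 5 =
        (phi (w ^ 4) + 2 * w * psi (w ^ 8)) * (phi (w ^ 20) - 2 * w ^ 5 * psi (w ^ 40)) ^ 5 +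
        (phi (w ^ 4) - 2 * w * psi (w ^ 8)) * (phi (w ^ 20) + 2 * w ^ 5 * psi (w ^ 40)) ^ 5 := by
      rw [s1, s2, s5, s6]; ring
    have hin : ((f 1 (w ^ 2) ^ 2 * f 5 (w ^ 2) ^ 2 + 2 * w ^ 2 *
          (f 2 (w ^ 2) ^ 4 * f 10 (w ^ 2) ^ 4 / (f 1 (w ^ 2) ^ 2 * f 5 (w ^ 2) ^ 2))) ^ 2 -
          4 * w ^ 4 * (f 2 (w ^ 2) ^ 8 / f 1 (w ^ 2) ^ 4) *
          (f 10 (w ^ 2) ^ 8 / f 5 (w ^ 2) ^ 4)) / (f 2 (w ^ 2) * f 10 (w ^ 2)) ^ 2 +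
        4 * w ^ 2 * (f 2 (w ^ 2) * f 10 (w ^ 2)) ^ 2 =
        f 1 (w ^ 2) ^ 4 * f 5 (w ^ 2) ^ 4 / (f 2 (w ^ 2) * f 10 (w ^ 2)) ^ 2 +
          8 * w ^ 2 * (f 2 (w ^ 2) ^ 2 * f 10 (w ^ 2) ^ 2) := by
      field_simp
      ring
    rw [c1, c2, ← mul_add, mul_div_assoc, hsum, key2, hin, cusp, corePairGF, corePairGF, ← g10, g2']
    linear_combination key
  · linear_combination (1 / 2) * m1 + (1 / 2) * p1
      - (1 / 2) * (phi w + phi (w ^ 4) + 2 * w * psi (w ^ 8)) * s1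
      - (1 / 2) * (phi (-w) + phi (w ^ 4) - 2 * w * psi (w ^ 8)) * s2
  · linear_combination (1 / 4) * m1 - (1 / 4) * p1
      - (1 / 4) * (phi w + phi (w ^ 4) + 2 * w * psi (w ^ 8)) * s1
      + (1 / 4) * (phi (-w) + phi (w ^ 4) - 2 * w * psi (w ^ 8)) * s2
  · linear_combination (1 / 2) * m5 + (1 / 2) * p5
      - (1 / 2) * (phi (w ^ 5) + phi (w ^ 20) + 2 * w ^ 5 * psi (w ^ 40)) * s5
      - (1 / 2) * (phi (-w ^ 5) + phi (w ^ 20) - 2 * w ^ 5 * psi (w ^ 40)) * s6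
  · linear_combination (1 / 4) * m5 - (1 / 4) * p5
      - (1 / 4) * (phi (w ^ 5) + phi (w ^ 20) + 2 * w ^ 5 * psi (w ^ 40)) * s5
      + (1 / 4) * (phi (-w ^ 5) + phi (w ^ 20) - 2 * w ^ 5 * psi (w ^ 40)) * s6
  · rw [← g2', g10]; linear_combination 2 * w * es
  · rw [← mul_pow, ← u1, ← v1]; ring
  · rw [← mul_pow, ← u5]; ring
  · rw [show f 5 (w ^ 2) ^ 8 / f 10 (w ^ 2) ^ 4 = (f 5 (w ^ 2) ^ 4 / f 10 (w ^ 2) ^ 2) ^ 2 by ring,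
      ← n5, mul_pow, m5, p5]
    ring

end evenParts

/-! ### Maya diagrams and hook numbers -/

/-- The beads of the Maya diagram of `μ`: the content of the last cell of row `i`, with the
convention that an empty row `i` ends in column `-1`. -/
def bead (μ : YoungDiagram) (i : ℕ) : ℤ := μ.rowLen i - i - 1

/-- The holes of the Maya diagram of `μ`. -/
def gap (μ : YoungDiagram) (j : ℕ) : ℤ := j - μ.colLen j

section beads

variable {μ : YoungDiagram}

lemma bead_strictAnti (μ : YoungDiagram) : StrictAnti (bead μ) :=
  strictAnti_nat_of_succ_lt fun i => by
    have := μ.rowLen_anti i (i + 1) (Nat.le_succ i)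
    simp only [bead]
    lia

lemma mem_iff_gap_lt_bead {i j : ℕ} : (i, j) ∈ μ ↔ gap μ j < bead μ i := by
  have h1 := YoungDiagram.mem_iff_lt_rowLen (μ := μ) (i := i) (j := j)
  have h2 := YoungDiagram.mem_iff_lt_colLen (μ := μ) (i := i) (j := j)
  simp only [gap, bead]
  by_cases h : (i, j) ∈ μ
  · have := h1.mp h
    have := h2.mp h
    exact ⟨fun _ => by lia, fun _ => h⟩
  · have := mt h1.mpr h
    have := mt h2.mpr h
    exact ⟨fun h' => absurd h (by lia), fun _ => by lia⟩

lemma bead_ne_gap (i j : ℕ) : bead μ i ≠ gap μ j := by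
  have h1 := YoungDiagram.mem_iff_lt_rowLen (μ := μ) (i := i) (j := j)
  have h2 := YoungDiagram.mem_iff_lt_colLen (μ := μ) (i := i) (j := j)
  simp only [gap, bead]
  by_cases h : (i, j) ∈ μ
  · have := h1.mp h
    have := h2.mp h
    lia
  · have := mt h1.mpr h
    have := mt h2.mpr h
    lia

lemma exists_rowLen_eq_zero (μ : YoungDiagram) : ∃ n, ∀ i ≥ n, μ.rowLen i = 0 := by
  refine ⟨μ.colLen 0, fun i hi => ?_⟩
  by_contra h
  have h1 := YoungDiagram.mem_iff_lt_rowLen.mpr (Nat.pos_of_ne_zero h)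
  have h2 := YoungDiagram.mem_iff_lt_colLen.mp h1
  lia

/-- Take the first row i whose bead is at most m. If it is not m, column m + i has length exactly i,
so its gap is m. -/
lemma exists_bead_or_gap (μ : YoungDiagram) (m : ℤ) : (∃ i, bead μ i = m) ∨ ∃ j, gap μ j = m := by
  have hex : ∃ i, bead μ i ≤ m := by
    obtain ⟨n, hn⟩ := exists_rowLen_eq_zero μ
    refine ⟨n + m.natAbs, ?_⟩
    rw [bead, hn _ (Nat.le_add_right _ _)]
    lia
  classical
  obtain ⟨i, hi, hmin⟩ : ∃ i, bead μ i ≤ m ∧ ∀ k < i, m < bead μ k :=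
    ⟨Nat.find hex, Nat.find_spec hex, fun k hk => not_le.mp (Nat.find_min hex hk)⟩
  rcases hi.eq_or_lt with h | h
  · exact Or.inl ⟨i, h⟩
  · right
    have hr : μ.rowLen i ≤ m + i := by simp only [bead] at h; lia
    obtain ⟨j, hj⟩ : ∃ j : ℕ, (j : ℤ) = m + i := ⟨(m + i).toNat, by lia⟩
    have h1 : (i, j) ∉ μ := fun hc => by
      have := YoungDiagram.mem_iff_lt_rowLen.mp hc
      lia
    have h2 : ∀ k < i, (k, j) ∈ μ := fun k hk => by
      have h3 := hmin (i - 1) (by lia)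
      simp only [bead] at h3
      exact μ.up_left_mem (i2 := i - 1) (by lia) le_rfl
        (YoungDiagram.mem_iff_lt_rowLen.mpr (by lia))
    have h3 : μ.colLen j = i := by
      refine le_antisymm (not_lt.mp fun hc => h1 (YoungDiagram.mem_iff_lt_colLen.mpr hc)) ?_
      rcases Nat.eq_zero_or_pos i with rfl | hpos
      · exact Nat.zero_le _
      · have := YoungDiagram.mem_iff_lt_colLen.mp (h2 (i - 1) (by lia))
        lia
    exact ⟨j, by rw [gap, h3]; lia⟩

/-- The hook is the disjoint union of a piece of row i, corner included, and the cells of column j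
strictly below the corner. -/
lemma hookNumber_eq {i j : ℕ} (h : (i, j) ∈ μ) :
    (hookNumber μ (i, j) : ℤ) = bead μ i - gap μ j := by
  have hr := YoungDiagram.mem_iff_lt_rowLen.mp h
  have hc := YoungDiagram.mem_iff_lt_colLen.mp h
  have hset : (μ.cells.filter fun d => (d.1 = i ∧ j ≤ d.2) ∨ (d.2 = j ∧ i ≤ d.1)) =
      (Finset.Ico j (μ.rowLen i)).image (fun b => (i, b)) ∪
        (Finset.Ico (i + 1) (μ.colLen j)).image fun a => (a, j) := by
    ext ⟨a, b⟩
    simp only [Finset.mem_filter, YoungDiagram.mem_cells, Finset.mem_union, Finset.mem_image,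
      Finset.mem_Ico, Prod.mk.injEq]
    constructor
    · rintro ⟨hm, ⟨rfl, hb⟩ | ⟨rfl, ha⟩⟩
      · exact Or.inl ⟨b, ⟨hb, YoungDiagram.mem_iff_lt_rowLen.mp hm⟩, rfl, rfl⟩
      · rcases ha.eq_or_lt with rfl | ha
        · exact Or.inl ⟨b, ⟨le_rfl, YoungDiagram.mem_iff_lt_rowLen.mp hm⟩, rfl, rfl⟩
        · exact Or.inr ⟨a, ⟨ha, YoungDiagram.mem_iff_lt_colLen.mp hm⟩, rfl, rfl⟩
    · rintro (⟨b', ⟨h1, h2⟩, rfl, rfl⟩ | ⟨a', ⟨h1, h2⟩, rfl, rfl⟩)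
      · exact ⟨YoungDiagram.mem_iff_lt_rowLen.mpr h2, Or.inl ⟨rfl, h1⟩⟩
      · exact ⟨YoungDiagram.mem_iff_lt_colLen.mpr h2, Or.inr ⟨rfl, by lia⟩⟩
  have hdisj : Disjoint ((Finset.Ico j (μ.rowLen i)).image (fun b => (i, b)))
      ((Finset.Ico (i + 1) (μ.colLen j)).image fun a => (a, j)) := by
    rw [Finset.disjoint_left]
    rintro ⟨a, b⟩ h1 h2
    simp only [Finset.mem_image, Finset.mem_Ico, Prod.mk.injEq] at h1 h2
    obtain ⟨_, _, rfl, _⟩ := h1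
    obtain ⟨_, ⟨h3, _⟩, rfl, _⟩ := h2
    lia
  rw [hookNumber, hset, Finset.card_union_of_disjoint hdisj,
    Finset.card_image_of_injective _ fun a b h => (Prod.mk.inj h).2,
    Finset.card_image_of_injective _ fun a b h => (Prod.mk.inj h).1, Nat.card_Ico, Nat.card_Ico,
    bead, gap]
  lia

/-- Hook numbers are the positive differences bead minus gap. A bead x with x - t a gap gives a hook
t; conversely, stability under subtraction of t makes the gap of a hook tk a bead, which is
impossible. -/
lemma isCore_iff {t : ℕ} (ht : 0 < t) :
    IsCore t μ ↔ ∀ x ∈ Set.range (bead μ), x - t ∈ Set.range (bead μ) := by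
  constructor
  · rintro h _ ⟨i, rfl⟩
    rcases exists_bead_or_gap μ (bead μ i - t) with hb | ⟨j, hj⟩
    · exact hb
    · have hm : (i, j) ∈ μ := mem_iff_gap_lt_bead.mpr (by lia)
      refine absurd ?_ (h _ hm)
      have := hookNumber_eq hm
      rw [show hookNumber μ (i, j) = t by lia]
  · rintro h ⟨i, j⟩ hm ⟨k, hk⟩
    have hiter : ∀ k : ℕ, bead μ i - t * k ∈ Set.range (bead μ) := by
      intro k
      induction k with
      | zero => simp
      | succ k ih =>
        convert h _ ih using 1
        push_cast
        ring
    obtain ⟨i', hi'⟩ := hiter k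
    have := hookNumber_eq hm
    refine bead_ne_gap i' j (hi'.trans ?_)
    rw [hk] at this
    push_cast at this
    linarith

lemma eq_of_range_bead_eq {μ ν : YoungDiagram} (h : Set.range (bead μ) = Set.range (bead ν)) :
    μ = ν := by
  have h1 : (fun i => -bead μ i) = fun i => -bead ν i := by
    refine (StrictMono.range_inj (fun a b hab => neg_lt_neg (bead_strictAnti μ hab))
      (fun a b hab => neg_lt_neg (bead_strictAnti ν hab))).mp ?_
    have := congrArg (fun s => Neg.neg '' s) h
    simpa only [← Set.range_comp, Function.comp_def] using this
  refine YoungDiagram.ext (Finset.ext ?_)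
  rintro ⟨i, j⟩
  have h2 := congrFun h1 i
  simp only [bead] at h2
  rw [YoungDiagram.mem_cells, YoungDiagram.mem_cells, YoungDiagram.mem_iff_lt_rowLen,
    YoungDiagram.mem_iff_lt_rowLen, show μ.rowLen i = ν.rowLen i by lia]

lemma card_eq_sum_rowLen {n : ℕ} (h : ∀ i ≥ n, μ.rowLen i = 0) :
    μ.card = ∑ i ∈ Finset.range n, μ.rowLen i := by
  have hmaps : ∀ c ∈ μ.cells, c.1 ∈ Finset.range n := by
    rintro ⟨i, j⟩ hc
    rw [Finset.mem_range]
    by_contra hi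
    have := YoungDiagram.mem_iff_lt_rowLen.mp ((YoungDiagram.mem_cells _).mp hc)
    rw [h i (not_lt.mp hi)] at this
    exact absurd this (Nat.not_lt_zero _)
  rw [YoungDiagram.card, Finset.card_eq_sum_card_fiberwise hmaps]
  exact Finset.sum_congr rfl fun i _ => (μ.rowLen_eq_card).symm

/-- The nontrivial part of the Maya diagram. -/
def beadFinset (μ : YoungDiagram) (n : ℕ) : Finset ℤ := (Finset.range n).image (bead μ)

lemma card_beadFinset (μ : YoungDiagram) (n : ℕ) : (beadFinset μ n).card = n := by
  rw [beadFinset, Finset.card_image_of_injective _ (bead_strictAnti μ).injective,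
    Finset.card_range]

lemma mem_beadFinset {n : ℕ} (h : ∀ i ≥ n, μ.rowLen i = 0) (x : ℤ) :
    x ∈ beadFinset μ n ↔ x ∈ Set.range (bead μ) ∧ -(n : ℤ) ≤ x := by
  simp only [beadFinset, Finset.mem_image, Finset.mem_range, Set.mem_range]
  constructor
  · rintro ⟨i, hi, rfl⟩
    exact ⟨⟨i, rfl⟩, by rw [bead]; lia⟩
  · rintro ⟨⟨i, rfl⟩, hx⟩
    refine ⟨i, ?_, rfl⟩
    by_contra hi
    rw [bead, h i (not_lt.mp hi)] at hx
    lia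

lemma card_eq_sum_beadFinset {n : ℕ} (h : ∀ i ≥ n, μ.rowLen i = 0) :
    (μ.card : ℤ) = ∑ x ∈ beadFinset μ n, x + ∑ i ∈ Finset.range n, ((i : ℤ) + 1) := by
  rw [beadFinset, Finset.sum_image (bead_strictAnti μ).injective.injOn, ← Finset.sum_add_distrib,
    card_eq_sum_rowLen h]
  push_cast
  exact Finset.sum_congr rfl fun i _ => by rw [bead]; ring

lemma exists_rowLen_eq {r : ℕ → ℕ} (hr : Antitone r) {n : ℕ} (hn : ∀ i ≥ n, r i = 0) :
    ∃ μ : YoungDiagram, ∀ i, μ.rowLen i = r i := by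
  let μ : YoungDiagram :=
    { cells := (Finset.range n ×ˢ Finset.range (r 0)).filter fun c => c.2 < r c.1
      isLowerSet := by
        rintro ⟨a, b⟩ ⟨a', b'⟩ ⟨h1, h2⟩ hm
        simp only [Finset.coe_filter, Finset.mem_product, Finset.mem_range,
          Set.mem_ofPred_eq] at hm h1 h2 ⊢
        have := hr h1
        lia }
  have hμ : ∀ i j, (i, j) ∈ μ ↔ j < r i := by
    intro i j
    rw [← YoungDiagram.mem_cells]
    simp only [μ, Finset.mem_filter, Finset.mem_product, Finset.mem_range]
    refine ⟨fun h => h.2, fun h => ⟨⟨?_, h.trans_le (hr (Nat.zero_le i))⟩, h⟩⟩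
    by_contra hi
    rw [hn i (not_lt.mp hi)] at h
    exact absurd h (Nat.not_lt_zero _)
  refine ⟨μ, fun i => eq_of_forall_lt_iff fun j => ?_⟩
  rw [← hμ, YoungDiagram.mem_iff_lt_rowLen]

/-- List S decreasingly, continue with -i-1 from i = n on, and take x_i + i + 1 as row lengths;
strict decrease of x makes them antitone. -/
lemma exists_range_bead_eq {n : ℕ} {S : Finset ℤ} (hcard : S.card = n)
    (hS : ∀ x ∈ S, -(n : ℤ) ≤ x) :
    ∃ μ : YoungDiagram, (∀ i ≥ n, μ.rowLen i = 0) ∧ beadFinset μ n = S := by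
  obtain ⟨e, he⟩ : ∃ e : Fin n ↪o ℤ, ∀ k, e k ∈ S :=
    ⟨S.orderEmbOfFin hcard, S.orderEmbOfFin_mem hcard⟩
  have hmem : ∀ k, -(n : ℤ) ≤ e k := fun k => hS _ (he k)
  obtain ⟨x, hx1, hx2⟩ : ∃ x : ℕ → ℤ, (∀ i (h : i < n), x i = e ⟨n - 1 - i, by lia⟩) ∧
      ∀ i ≥ n, x i = -i - 1 :=
    ⟨fun i => if h : i < n then e ⟨n - 1 - i, by lia⟩ else -i - 1, fun i h => dif_pos h,
      fun i h => dif_neg (not_lt.mpr h)⟩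
  have hx : StrictAnti x := by
    refine strictAnti_nat_of_succ_lt fun i => ?_
    rcases lt_trichotomy (i + 1) n with h | h | h
    · rw [hx1 i (by lia), hx1 (i + 1) h]
      exact e.strictMono (by simp only [Fin.mk_lt_mk]; lia)
    · rw [hx1 i (by lia), hx2 (i + 1) h.ge]
      have := hmem ⟨n - 1 - i, by lia⟩
      push_cast
      lia
    · rw [hx2 i (by lia), hx2 (i + 1) (by lia)]
      push_cast
      lia
  have hanti : Antitone fun i => x i + i + 1 := by
    refine antitone_nat_of_succ_le fun i => ?_
    have := hx (Nat.lt_succ_self i)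
    simp only [Nat.succ_eq_add_one] at this
    push_cast
    lia
  have hzero : ∀ i ≥ n, x i + i + 1 = 0 := fun i hi => by
    rw [hx2 i hi]
    ring
  have hnonneg : ∀ i, 0 ≤ x i + i + 1 := fun i => by
    rw [← hzero (max i n) (le_max_right _ _)]
    exact hanti (le_max_left i n)
  obtain ⟨μ, hμ⟩ := exists_rowLen_eq (r := fun i => (x i + i + 1).toNat)
    (fun a b hab => Int.toNat_le_toNat (hanti hab)) (n := n) fun i hi => by
      simp only [hzero i hi, Int.toNat_zero]
  have hb : bead μ = x := by
    ext i
    have := hnonneg i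
    rw [bead, hμ]
    lia
  refine ⟨μ, fun i hi => by rw [hμ, hzero i hi, Int.toNat_zero], ?_⟩
  refine Finset.eq_of_subset_of_card_le ?_ (by rw [card_beadFinset, hcard])
  intro y hy
  obtain ⟨i, hi, rfl⟩ := Finset.mem_image.mp hy
  rw [hb, hx1 i (Finset.mem_range.mp hi)]
  exact he _

end beads

/-! ### Charge vectors of t-cores -/

section coreVectors

variable {t : ℕ} [NeZero t] {μ : YoungDiagram}

/-- The set of beads of the `t`-core with charge vector `c`: on the runner of residue `r` the
positions `k t + r` with `k < c r` are occupied. -/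
def coreSet (c : Fin t → ℤ) : Set ℤ :=
  {x | (Int.divModEquiv t x).1 < c (Int.divModEquiv t x).2}

lemma exists_eq_mul_add (t : ℕ) [NeZero t] (x : ℤ) :
    ∃ (k : ℤ) (r : Fin t), x = k * t + (r : ℕ) := by
  obtain ⟨⟨k, r⟩, rfl⟩ := (Int.divModEquiv t).symm.surjective x
  exact ⟨k, r, rfl⟩

lemma divModEquiv_mul_add (k : ℤ) (r : Fin t) :
    Int.divModEquiv t (k * t + (r : ℕ)) = (k, r) :=
  (Int.divModEquiv t).apply_symm_apply (k, r)

lemma mem_coreSet {c : Fin t → ℤ} {k : ℤ} {r : Fin t} :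
    k * t + (r : ℕ) ∈ coreSet c ↔ k < c r := by
  rw [coreSet, Set.mem_ofPred_eq, divModEquiv_mul_add]

lemma coreSet_injective : Function.Injective (coreSet (t := t)) := by
  intro c d h
  ext r
  refine eq_of_forall_lt_iff fun k => ?_
  rw [← mem_coreSet, ← mem_coreSet, h]

lemma sub_mem_coreSet {c : Fin t → ℤ} {x : ℤ} (hx : x ∈ coreSet c) : x - t ∈ coreSet c := by
  obtain ⟨k, r, rfl⟩ := exists_eq_mul_add t x
  have hk := mem_coreSet.mp hx
  rw [show k * (t : ℤ) + (r : ℕ) - t = (k - 1) * t + (r : ℕ) by ring, mem_coreSet]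
  lia

/-- The elements of `coreSet c` that are at least `-t L`, if `-L ≤ c r` for all `r`. -/
noncomputable def coreFinset (c : Fin t → ℤ) (L : ℕ) : Finset ℤ :=
  (Finset.univ.sigma fun r : Fin t => Finset.Ico (-(L : ℤ)) (c r)).image
    fun p => p.2 * t + (p.1 : ℕ)

lemma mul_add_injective :
    Function.Injective fun p : (_ : Fin t) × ℤ => p.2 * (t : ℤ) + (p.1 : ℕ) := by
  rintro ⟨r, k⟩ ⟨r', k'⟩ h
  have h' := congrArg (Int.divModEquiv t) h
  simp only [divModEquiv_mul_add, Prod.mk.injEq] at h'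
  obtain ⟨rfl, rfl⟩ := h'
  rfl

lemma le_mul_add_iff {t L : ℕ} {k : ℤ} {r : Fin t} :
    -((t * L : ℕ) : ℤ) ≤ k * t + (r : ℕ) ↔ -(L : ℤ) ≤ k := by
  have hr := r.isLt
  push_cast
  constructor
  · intro h
    by_contra hk
    have : k * (t : ℤ) ≤ (-(L : ℤ) - 1) * t :=
      mul_le_mul_of_nonneg_right (by lia) (Int.natCast_nonneg t)
    linarith [show ((r : ℕ) : ℤ) < t by exact_mod_cast hr]
  · intro h
    have : (-(L : ℤ)) * t ≤ k * t := mul_le_mul_of_nonneg_right h (Int.natCast_nonneg t)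
    linarith [Int.natCast_nonneg (r : ℕ)]

lemma mem_coreFinset {c : Fin t → ℤ} {L : ℕ} (x : ℤ) :
    x ∈ coreFinset c L ↔ x ∈ coreSet c ∧ -((t * L : ℕ) : ℤ) ≤ x := by
  obtain ⟨k, r, rfl⟩ := exists_eq_mul_add t x
  rw [mem_coreSet, le_mul_add_iff, coreFinset, Finset.mem_image]
  constructor
  · rintro ⟨⟨r', k'⟩, hm, h⟩
    obtain ⟨rfl, rfl⟩ := Sigma.mk.inj (mul_add_injective (a₁ := ⟨r', k'⟩) (a₂ := ⟨r, k⟩) h)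
    simp only [Finset.mem_sigma, Finset.mem_univ, Finset.mem_Ico, true_and] at hm
    exact ⟨hm.2, hm.1⟩
  · rintro ⟨h1, h2⟩
    exact ⟨⟨r, k⟩, by simp [h1, h2], rfl⟩

lemma card_coreFinset {c : Fin t → ℤ} {L : ℕ} (hL : ∀ r, -(L : ℤ) ≤ c r) :
    ((coreFinset c L).card : ℤ) = ∑ r, c r + (t * L : ℕ) := by
  rw [coreFinset, Finset.card_image_of_injective _ mul_add_injective, Finset.card_sigma]
  push_cast
  rw [Finset.sum_congr rfl fun r _ => show ((Finset.Ico (-(L : ℤ)) (c r)).card : ℤ) = c r + L by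
    rw [Int.card_Ico]; have := hL r; lia]
  rw [Finset.sum_add_distrib]
  simp

lemma sum_Ico_mul_add (a s : ℤ) {b d : ℤ} (h : b ≤ d) :
    ∑ k ∈ Finset.Ico b d, (k * a + s) = a * (tri d - tri b) + s * (d - b) := by
  induction d, h using Int.leInduction with
  | base => simp
  | succ d hd ih =>
    rw [← Finset.insert_Ico_right_eq_Ico_add_one hd, Finset.sum_insert (by simp), ih, tri_add_one]
    ring

lemma sum_coreFinset {c : Fin t → ℤ} {L : ℕ} (hL : ∀ r, -(L : ℤ) ≤ c r) :
    ∑ x ∈ coreFinset c L, x = ∑ r, (t * tri (c r) + (r : ℕ) * c r) +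
      ∑ r : Fin t, ((r : ℕ) * (L : ℤ) - t * tri (-L)) := by
  rw [coreFinset, Finset.sum_image mul_add_injective.injOn, Finset.sum_sigma,
    ← Finset.sum_add_distrib]
  refine Finset.sum_congr rfl fun r _ => ?_
  refine (sum_Ico_mul_add (t : ℤ) ((r : ℕ) : ℤ) (hL r)).trans ?_
  ring

/-- The zero vector is the empty partition, with the negative integers as beads. This evaluates the
terms of `sum_coreFinset` that do not depend on c. -/
lemma sum_coreFinset_zero (L : ℕ) :
    ∑ x ∈ coreFinset (0 : Fin t → ℤ) L, x = -∑ i ∈ Finset.range (t * L), ((i : ℤ) + 1) := by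
  have h : coreFinset (0 : Fin t → ℤ) L =
      (Finset.range (t * L)).image fun i : ℕ => -((i : ℤ) + 1) := by
    ext x
    rw [mem_coreFinset, Finset.mem_image]
    have hx : x ∈ coreSet (0 : Fin t → ℤ) ↔ x < 0 := by
      obtain ⟨k, r, rfl⟩ := exists_eq_mul_add t x
      have h0 := le_mul_add_iff (L := 0) (k := k) (r := r)
      rw [mem_coreSet, Pi.zero_apply]
      simp only [mul_zero, Nat.cast_zero, neg_zero] at h0
      lia
    rw [hx]
    constructor
    · rintro ⟨h1, h2⟩
      exact ⟨(-x - 1).toNat, by rw [Finset.mem_range]; lia, by lia⟩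
    · rintro ⟨i, hi, rfl⟩
      rw [Finset.mem_range] at hi
      lia
  rw [h, Finset.sum_image fun a _ b _ hab => by simpa using hab, Finset.sum_neg_distrib]

lemma card_eq_of_beadFinset_eq {c : Fin t → ℤ} {L : ℕ} (hL : ∀ r, -(L : ℤ) ≤ c r)
    (hμ : ∀ i ≥ t * L, μ.rowLen i = 0) (h : beadFinset μ (t * L) = coreFinset c L) :
    (μ.card : ℤ) = ∑ r, (t * tri (c r) + (r : ℕ) * c r) := by
  have h0 := sum_coreFinset (c := (0 : Fin t → ℤ)) (L := L) fun r => by simp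
  rw [sum_coreFinset_zero] at h0
  simp only [Pi.zero_apply, tri_zero, mul_zero, add_zero, Finset.sum_const_zero, zero_add] at h0
  rw [card_eq_sum_beadFinset hμ, h, sum_coreFinset hL, ← h0]
  ring

lemma mem_range_bead_of_lt {n : ℕ} (hμ : ∀ i ≥ n, μ.rowLen i = 0) {x : ℤ} (hx : x < -n) :
    x ∈ Set.range (bead μ) :=
  ⟨(-x - 1).toNat, by rw [bead, hμ _ (by lia)]; lia⟩

lemma mem_coreSet_of_lt {c : Fin t → ℤ} {L : ℕ} (hL : ∀ r, -(L : ℤ) ≤ c r) {x : ℤ}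
    (hx : x < -((t * L : ℕ) : ℤ)) : x ∈ coreSet c := by
  obtain ⟨k, r, rfl⟩ := exists_eq_mul_add t x
  have h := le_mul_add_iff (L := L) (k := k) (r := r)
  rw [mem_coreSet]
  have := hL r
  lia

lemma beadFinset_eq_coreFinset_iff {c : Fin t → ℤ} {L : ℕ} (hL : ∀ r, -(L : ℤ) ≤ c r)
    (hμ : ∀ i ≥ t * L, μ.rowLen i = 0) :
    beadFinset μ (t * L) = coreFinset c L ↔ Set.range (bead μ) = coreSet c := by
  constructor
  · intro h
    ext x
    rcases lt_or_ge x (-((t * L : ℕ) : ℤ)) with hx | hx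
    · exact iff_of_true (mem_range_bead_of_lt hμ hx) (mem_coreSet_of_lt hL hx)
    · have := Finset.ext_iff.mp h x
      rw [mem_beadFinset hμ, mem_coreFinset] at this
      rwa [and_iff_left hx, and_iff_left hx] at this
  · intro h
    ext x
    rw [mem_beadFinset hμ, mem_coreFinset, h]

lemma exists_bound {t : ℕ} (c : Fin t → ℤ) : ∃ L : ℕ, ∀ r, -(L : ℤ) ≤ c r := by
  refine ⟨∑ r, (c r).natAbs, fun r => ?_⟩
  have := Finset.single_le_sum (f := fun r => (c r).natAbs) (fun _ _ => Nat.zero_le _)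
    (Finset.mem_univ r)
  lia

lemma exists_range_bead_eq_coreSet {c : Fin t → ℤ} (hc : ∑ r, c r = 0) :
    ∃ μ : YoungDiagram, Set.range (bead μ) = coreSet c ∧
      (μ.card : ℤ) = ∑ r, (t * tri (c r) + (r : ℕ) * c r) := by
  obtain ⟨L, hL⟩ := exists_bound c
  have hcard := card_coreFinset hL
  rw [hc, zero_add, Nat.cast_inj] at hcard
  obtain ⟨μ, hμ, h⟩ := exists_range_bead_eq hcard fun x hx => ((mem_coreFinset x).mp hx).2
  exact ⟨μ, (beadFinset_eq_coreFinset_iff hL hμ).mp h, card_eq_of_beadFinset_eq hL hμ h⟩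

/-- Stability under subtraction of t makes each runner an initial segment, whose end is c r. The sum
vanishes because a long enough truncation at -N contains exactly N beads. -/
lemma exists_coreSet_eq_range_bead (h : IsCore t μ) :
    ∃ c : Fin t → ℤ, ∑ r, c r = 0 ∧ Set.range (bead μ) = coreSet c := by
  have ht : 0 < t := NeZero.pos t
  rw [isCore_iff ht] at h
  obtain ⟨n, hn⟩ := exists_rowLen_eq_zero μ
  have hdown : ∀ (r : Fin t) (k : ℤ), k * t + (r : ℕ) ∈ Set.range (bead μ) →
      ∀ m ≤ k, m * t + (r : ℕ) ∈ Set.range (bead μ) := by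
    intro r k hk m hm
    induction m, hm using Int.leInductionDown with
    | base => exact hk
    | pred m _ ih =>
      convert h _ ih using 1
      ring
  have hex : ∀ r : Fin t, ∃ c : ℤ, ∀ k : ℤ, k * t + (r : ℕ) ∈ Set.range (bead μ) ↔ k < c := by
    intro r
    have ht1 : (1 : ℤ) ≤ t := by exact_mod_cast ht
    have hbdd : ∃ b : ℤ, ∀ k : ℤ, k * t + (r : ℕ) ∈ Set.range (bead μ) → k ≤ b := by
      refine ⟨(bead μ 0).natAbs, ?_⟩
      rintro k ⟨i, hi⟩
      have h1 := (bead_strictAnti μ).antitone (Nat.zero_le i)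
      by_contra hk
      have h2 : k ≤ k * t := by nlinarith
      lia
    have hne : ∃ k : ℤ, k * t + (r : ℕ) ∈ Set.range (bead μ) := by
      refine ⟨-n - 1, mem_range_bead_of_lt hn ?_⟩
      have h3 : ((r : ℕ) : ℤ) < t := by exact_mod_cast r.isLt
      nlinarith
    obtain ⟨u, hu, hmax⟩ := Int.exists_greatest_of_bdd hbdd hne
    exact ⟨u + 1, fun k => ⟨fun hk => by have := hmax k hk; lia,
      fun hk => hdown r u hu k (by lia)⟩⟩
  choose c hc using hex
  have hrange : Set.range (bead μ) = coreSet c := by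
    ext x
    obtain ⟨k, r, rfl⟩ := exists_eq_mul_add t x
    rw [hc, mem_coreSet]
  refine ⟨c, ?_, hrange⟩
  obtain ⟨L, hL⟩ := exists_bound c
  have hL' : ∀ r, -((L + n : ℕ) : ℤ) ≤ c r := fun r => by have := hL r; lia
  have hμ : ∀ i ≥ t * (L + n), μ.rowLen i = 0 := fun i hi => hn i (by nlinarith)
  have hcard := card_coreFinset hL'
  rw [← (beadFinset_eq_coreFinset_iff hL' hμ).mpr hrange, card_beadFinset] at hcard
  lia

/-- The Garvan–Kim–Stanton parametrization of `t`-cores by integer vectors of sum zero. -/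
lemma exists_equiv_isCore (t : ℕ) [NeZero t] :
    ∃ e : {c : Fin t → ℤ // ∑ r, c r = 0} ≃ {μ : YoungDiagram // IsCore t μ},
      ∀ c, ((e c).1.card : ℤ) = ∑ r, (t * tri (c.1 r) + (r : ℕ) * c.1 r) := by
  choose φ hφ1 hφ2 using fun c : {c : Fin t → ℤ // ∑ r, c r = 0} =>
    exists_range_bead_eq_coreSet c.2
  have hcore : ∀ c, IsCore t (φ c) := fun c => by
    rw [isCore_iff (NeZero.pos t), hφ1]
    exact fun x hx => sub_mem_coreSet hx
  refine ⟨Equiv.ofBijective (fun c => ⟨φ c, hcore c⟩) ⟨fun c d hcd => ?_, ?_⟩, hφ2⟩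
  · have h : φ c = φ d := congrArg Subtype.val hcd
    exact Subtype.ext (coreSet_injective (by rw [← hφ1, ← hφ1, h]))
  · rintro ⟨μ, hμ⟩
    obtain ⟨c, hc, h⟩ := exists_coreSet_eq_range_bead hμ
    exact ⟨⟨c, hc⟩, Subtype.ext (eq_of_range_bead_eq (by rw [hφ1, h]))⟩

end coreVectors

/-! ### The generating function of t-cores as a constant term -/

lemma hasSum_prod_pi {n : ℕ} {a : Fin n → ℤ → ℂ} (ha : ∀ r, Summable fun k => ‖a r k‖) :
    (Summable fun v : Fin n → ℤ => ‖∏ r, a r (v r)‖) ∧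
      HasSum (fun v : Fin n → ℤ => ∏ r, a r (v r)) (∏ r, ∑' k, a r k) := by
  induction n with
  | zero => exact ⟨Summable.of_finite, by simp⟩
  | succ n ih =>
    obtain ⟨h1, h2⟩ := ih (a := fun r => a r.succ) fun r => ha r.succ
    have hs := summable_mul_of_summable_norm (ha 0) h1
    have hs' : Summable fun p : ℤ × (Fin n → ℤ) => ‖a 0 p.1 * ∏ r, a (Fin.succ r) (p.2 r)‖ :=
      hs.norm
    let e : ℤ × (Fin n → ℤ) ≃ (Fin (n + 1) → ℤ) := Fin.consEquiv fun _ => ℤ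
    have he : (fun v : Fin (n + 1) → ℤ => ∏ r, a r (v r)) ∘ e =
        fun p : ℤ × (Fin n → ℤ) => a 0 p.1 * ∏ r, a (Fin.succ r) (p.2 r) := by
      ext p
      simp [e, Fin.consEquiv, Fin.prod_univ_succ]
    constructor
    · refine e.summable_iff.mp ?_
      convert hs' using 1
      ext p
      exact congrArg norm (congrFun he p)
    · rw [Fin.prod_univ_succ, ← e.hasSum_iff, he]
      have h0 : HasSum (a 0) (∑' k, a 0 k) := (ha 0).of_norm.hasSum
      exact HasSum.mul (f := a 0) (g := fun v : Fin n → ℤ => ∏ r, a (Fin.succ r) (v r)) h0 h2 hs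

lemma integral_exp_zpow (d : ℤ) :
    ∫ θ in (0 : ℝ)..2 * Real.pi, Complex.exp (θ * Complex.I) ^ d =
      if d = 0 then 2 * (Real.pi : ℂ) else 0 := by
  split_ifs with h
  · simp [h]
  · have hc : (d : ℂ) * Complex.I ≠ 0 := mul_ne_zero (by exact_mod_cast h) Complex.I_ne_zero
    have he : ∀ θ : ℝ, Complex.exp (θ * Complex.I) ^ d = Complex.exp (d * Complex.I * θ) := by
      intro θ
      rw [← Complex.exp_int_mul]
      ring_nf
    simp only [he]
    rw [integral_exp_mul_complex hc]
    have h2 : (d : ℂ) * Complex.I * ((2 * Real.pi : ℝ) : ℂ) = d * (2 * Real.pi * Complex.I) := by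
      push_cast; ring
    rw [h2, Complex.exp_int_mul_two_pi_mul_I]
    simp

/-- The constant term of an absolutely convergent Laurent series on the unit circle. -/
lemma hasSum_constant_term {ι : Type*} [Countable ι] {a : ι → ℂ} {d : ι → ℤ} {g : ℝ → ℂ}
    (ha : Summable fun i => ‖a i‖)
    (hg : ∀ θ : ℝ, HasSum (fun i => a i * Complex.exp (θ * Complex.I) ^ d i) (g θ)) :
    HasSum (fun i => if d i = 0 then a i else 0)
      ((∫ θ in (0 : ℝ)..2 * Real.pi, g θ) / (2 * Real.pi)) := by
  have hpi : (2 * (Real.pi : ℂ)) ≠ 0 := by exact_mod_cast Real.two_pi_pos.ne'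
  have hcont : ∀ i, Continuous fun θ : ℝ => a i * Complex.exp (θ * Complex.I) ^ d i := fun i =>
    continuous_const.mul ((by fun_prop : Continuous fun θ : ℝ =>
      Complex.exp (θ * Complex.I)).zpow₀ _ fun θ => Or.inl (Complex.exp_ne_zero _))
  have h := intervalIntegral.hasSum_integral_of_dominated_convergence (a := 0)
    (b := 2 * Real.pi) (μ := MeasureTheory.volume) (fun i _ => ‖a i‖)
    (fun i => (hcont i).aestronglyMeasurable)
    (fun i => Eventually.of_forall fun θ _ => by
      rw [norm_mul, norm_zpow, Complex.norm_exp_ofReal_mul_I, one_zpow, mul_one])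
    (Eventually.of_forall fun θ _ => ha) intervalIntegrable_const
    (Eventually.of_forall fun θ _ => hg θ)
  refine HasSum.congr_fun (h.div_const (2 * (Real.pi : ℂ))) fun i => ?_
  rw [intervalIntegral.integral_const_mul, integral_exp_zpow]
  split_ifs
  · field_simp
  · simp

lemma zpow_sum_eq_prod {ι : Type*} {x : ℂ} (hx : x ≠ 0) (s : Finset ι) (g : ι → ℤ) :
    x ^ ∑ i ∈ s, g i = ∏ i ∈ s, x ^ g i := by
  classical
  induction s using Finset.induction_on with
  | empty => simp
  | insert i s hi ih => rw [Finset.sum_insert hi, Finset.prod_insert hi, zpow_add₀ hx, ih]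

section constantTerm

variable {q : ℂ} (t : ℕ) [NeZero t]

/-- After the triple product, the factors for the nomes q^t are those for q sorted by residue modulo
t. -/
lemma prod_theta_eq {z : ℂ} (hz : z ≠ 0) (hq0 : q ≠ 0) (hq : ‖q‖ < 1) :
    ∏ r : Fin t, theta (z * q ^ (r : ℕ)) (q ^ t) = f t q ^ t / f 1 q * theta z q := by
  have ht := NeZero.ne t
  have h1 := f_ne_zero one_ne_zero hq
  have hqt := norm_pow_lt_one hq ht
  have hrev : pochInf (z⁻¹ * q) q =
      ∏ r : Fin t, pochInf ((z * q ^ (r : ℕ))⁻¹ * q ^ t) (q ^ t) := by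
    -- The residues must be reversed: z⁻¹ q · q^{t-1-r} = (z q^r)⁻¹ q^t.
    rw [pochInf_eq_prod _ hq t, ← Equiv.prod_comp Fin.revPerm]
    refine Finset.prod_congr rfl fun r _ => ?_
    congr 1
    rw [Fin.revPerm_apply, Fin.val_rev]
    obtain ⟨k, hk⟩ : ∃ k, t = r + 1 + k := ⟨t - (r + 1), by lia⟩
    rw [show t - ((r : ℕ) + 1) = k by lia]
    conv_rhs => rw [show q ^ t = q ^ ((r : ℕ) + 1 + k) by rw [← hk]]
    rw [pow_add, pow_add]
    field_simp
  have hth : ∀ r : Fin t, theta (z * q ^ (r : ℕ)) (q ^ t) = f t q *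
      pochInf (z * q ^ (r : ℕ)) (q ^ t) * pochInf ((z * q ^ (r : ℕ))⁻¹ * q ^ t) (q ^ t) := by
    intro r
    rw [theta_eq_pochInf (mul_ne_zero hz (pow_ne_zero _ hq0)) (pow_ne_zero _ hq0) hqt, f_pow,
      mul_one]
  rw [Finset.prod_congr rfl fun r _ => hth r, Finset.prod_mul_distrib, Finset.prod_mul_distrib,
    ← hrev, ← pochInf_eq_prod z hq t, theta_eq_pochInf hz hq0 hq]
  simp only [Finset.prod_const, Finset.card_univ, Fintype.card_fin]
  field_simp

/-- The weight of a charge vector, which is the size of the corresponding `t`-core. -/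
def vectorSize (c : Fin t → ℤ) : ℤ := ∑ r : Fin t, (t * tri (c r) + (r : ℕ) * c r)

/-- Expansion of `prod_theta_eq`: z records the sum of the charges, so its constant term is the sum
over t-cores. -/
lemma summable_vectorSize_and_hasSum (hq0 : q ≠ 0) (hq : ‖q‖ < 1) {z : ℂ} (hz : z ≠ 0) :
    (Summable fun c : Fin t → ℤ => ‖q ^ vectorSize t c * z ^ ∑ r, c r‖) ∧
    HasSum (fun c : Fin t → ℤ => q ^ vectorSize t c * z ^ ∑ r, c r)
      (f t q ^ t / f 1 q * theta z q) := by
  have hqt := norm_pow_lt_one hq (NeZero.ne t)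
  have hterm : ∀ c : Fin t → ℤ, ∏ r : Fin t, ((z * q ^ (r : ℕ)) ^ c r * (q ^ t) ^ tri (c r)) =
      q ^ vectorSize t c * z ^ ∑ r, c r := by
    intro c
    rw [vectorSize, zpow_sum_eq_prod hq0, zpow_sum_eq_prod hz, ← Finset.prod_mul_distrib]
    refine Finset.prod_congr rfl fun r _ => ?_
    rw [mul_zpow, zpow_add₀ hq0, zpow_mul, zpow_mul, zpow_natCast, zpow_natCast]
    ring
  have h := hasSum_prod_pi (a := fun (r : Fin t) k => (z * q ^ (r : ℕ)) ^ k * (q ^ t) ^ tri k)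
    fun r => (summable_theta (mul_ne_zero hz (pow_ne_zero _ hq0)) (pow_ne_zero _ hq0) hqt).norm
  have h3 : ∏ r : Fin t, ∑' k : ℤ, (z * q ^ (r : ℕ)) ^ k * (q ^ t) ^ tri k =
      f t q ^ t / f 1 q * theta z q := prod_theta_eq t hz hq0 hq
  simp only [hterm, h3] at h
  exact h

lemma integral_theta (hq0 : q ≠ 0) (hq : ‖q‖ < 1) (C : ℂ) :
    (∫ θ in (0 : ℝ)..2 * Real.pi, C * theta (Complex.exp (θ * Complex.I)) q) / (2 * Real.pi) =
      C := by
  have hs : Summable fun n : ℤ => ‖C * q ^ tri n‖ := by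
    simpa using ((summable_theta one_ne_zero hq0 hq).mul_left C).norm
  have h := hasSum_constant_term hs (d := fun n => n)
    (g := fun θ => C * theta (Complex.exp (θ * Complex.I)) q) fun θ => by
      refine HasSum.congr_fun
        ((summable_theta (Complex.exp_ne_zero _) hq0 hq).hasSum.mul_left C) fun n => ?_
      ring
  refine h.unique ?_
  convert hasSum_single (0 : ℤ) fun n hn => ?_ using 1
  · simp [tri_zero]
  · exact if_neg hn

lemma summable_vectorSize (hq0 : q ≠ 0) (hq : ‖q‖ < 1) :
    Summable fun c : Fin t → ℤ => ‖q ^ vectorSize t c‖ := by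
  simpa using (summable_vectorSize_and_hasSum t hq0 hq one_ne_zero).1

lemma hasSum_vectorSize_ite (hq0 : q ≠ 0) (hq : ‖q‖ < 1) :
    HasSum (fun c : Fin t → ℤ => if ∑ r, c r = 0 then q ^ vectorSize t c else 0)
      (f t q ^ t / f 1 q) := by
  have hg : ∀ θ : ℝ, HasSum
      (fun c : Fin t → ℤ => q ^ vectorSize t c * Complex.exp (θ * Complex.I) ^ ∑ r, c r)
      (f t q ^ t / f 1 q * theta (Complex.exp (θ * Complex.I)) q) := fun θ =>
    (summable_vectorSize_and_hasSum t hq0 hq (Complex.exp_ne_zero _)).2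
  have h1 := hasSum_constant_term (a := fun c : Fin t → ℤ => q ^ vectorSize t c)
    (d := fun c => ∑ r, c r) (summable_vectorSize t hq0 hq) hg
  have h2 := integral_theta hq0 hq (f t q ^ t / f 1 q)
  exact h2 ▸ h1

lemma hasSum_charge_vectors (hq0 : q ≠ 0) (hq : ‖q‖ < 1) :
    HasSum (fun c : {c : Fin t → ℤ // ∑ r, c r = 0} => q ^ vectorSize t c.1)
      (f t q ^ t / f 1 q) := by
  have h1 := hasSum_vectorSize_ite t hq0 hq
  have hinj : Function.Injective (Subtype.val : {c : Fin t → ℤ // ∑ r, c r = 0} → Fin t → ℤ) :=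
    Subtype.val_injective
  have h2 := (hinj.hasSum_iff fun c hc => if_neg fun h => hc ⟨⟨c, h⟩, rfl⟩).mpr h1
  refine HasSum.congr_fun h2 fun c => ?_
  rw [Function.comp, if_pos c.2]

/-- The generating function of `t`-cores. -/
theorem hasSum_isCore (hq0 : q ≠ 0) (hq : ‖q‖ < 1) :
    (Summable fun μ : {μ : YoungDiagram // IsCore t μ} => ‖q ^ μ.1.card‖) ∧
    HasSum (fun μ : {μ : YoungDiagram // IsCore t μ} => q ^ μ.1.card) (f t q ^ t / f 1 q) := by
  obtain ⟨e, he⟩ := exists_equiv_isCore t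
  have h1 := summable_vectorSize t hq0 hq
  have h2 := hasSum_charge_vectors t hq0 hq
  have hfun : (fun μ : {μ : YoungDiagram // IsCore t μ} => q ^ μ.1.card) ∘ e =
      fun c : {c : Fin t → ℤ // ∑ r, c r = 0} =>
        q ^ vectorSize t c.1 := by
    ext c
    rw [Function.comp, ← zpow_natCast, he, vectorSize]
  constructor
  · refine e.summable_iff.mp ?_
    refine (h1.comp_injective Subtype.val_injective).congr fun c => ?_
    exact congrArg norm (congrFun hfun c).symm
  · rw [← e.hasSum_iff, hfun]
    exact h2

end constantTerm

/-! ### Pairs of cores and the iteration of U₂ -/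

/-- Pairs of `t`-cores of total size `n`, as a fibre of the total size. -/
def corePairsEquivFiber (t n : ℕ) : corePairs t n ≃ {p : {μ : YoungDiagram // IsCore t μ} ×
    {μ : YoungDiagram // IsCore t μ} // p.1.1.card + p.2.1.card = n} where
  toFun p := ⟨(⟨p.1.1, p.2.1⟩, ⟨p.1.2, p.2.2.1⟩), p.2.2.2⟩
  invFun p := ⟨(p.1.1.1, p.1.2.1), p.1.1.2, p.1.2.2, p.2⟩
  left_inv _ := rfl
  right_inv _ := rfl

/-- The generating function of pairs of `t`-cores. -/
lemma hasSum_A (t : ℕ) [NeZero t] {q : ℂ} (hq0 : q ≠ 0) (hq : ‖q‖ < 1) :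
    HasSum (fun n => (A t n : ℂ) * q ^ n) ((f t q ^ t / f 1 q) ^ 2) := by
  obtain ⟨hs, h⟩ := hasSum_isCore t hq0 hq
  have hs2 := summable_mul_of_summable_norm hs hs
  have h2 := HasSum.mul (f := fun μ : {μ : YoungDiagram // IsCore t μ} => q ^ μ.1.card)
    (g := fun μ : {μ : YoungDiagram // IsCore t μ} => q ^ μ.1.card) h h hs2
  let size : {μ : YoungDiagram // IsCore t μ} × {μ : YoungDiagram // IsCore t μ} → ℕ :=
    fun p => p.1.1.card + p.2.1.card
  have h3 := ((Equiv.sigmaFiberEquiv size).hasSum_iff.mpr h2)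
  rw [sq]
  refine HasSum.sigma h3 fun n => ?_
  have : Finite (corePairs t n) := (corePairs_finite t n).to_subtype
  have : Finite {p // size p = n} := Finite.of_equiv _ (corePairsEquivFiber t n)
  have := Fintype.ofFinite {p // size p = n}
  have hterm : (fun c : {p // size p = n} =>
      ((fun p : {μ : YoungDiagram // IsCore t μ} × {μ : YoungDiagram // IsCore t μ} =>
        q ^ p.1.1.card * q ^ p.2.1.card) ∘ Equiv.sigmaFiberEquiv size) ⟨n, c⟩) =
      fun _ => q ^ n := by
    ext c
    rw [Function.comp, ← pow_add]
    exact congrArg (q ^ ·) c.2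
  have hcard : A t n = Fintype.card {p // size p = n} := by
    rw [A, ← Nat.card_coe_set_eq, Nat.card_congr (corePairsEquivFiber t n),
      ← Nat.card_eq_fintype_card]
  rw [hterm, hcard, ← nsmul_eq_mul, ← Finset.card_univ, ← Finset.sum_const]
  exact hasSum_fintype _

/-- The coefficients of `corePairGF`. -/
noncomputable def coeffA (m : ℕ) : ℂ := if 2 ≤ m then A 5 (m - 2) else 0

lemma hasSum_coeffA {q : ℂ} (hq0 : q ≠ 0) (hq : ‖q‖ < 1) :
    HasSum (fun m => coeffA m * q ^ m) (corePairGF q) := by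
  refine (hasSum_nat_add_iff' 2).mp ?_
  have h := (hasSum_A 5 hq0 hq).mul_left (q ^ 2)
  simp only [Finset.sum_range_succ, Finset.sum_range_zero, coeffA]
  norm_num
  rw [show corePairGF q = q ^ 2 * (f 5 q ^ 5 / f 1 q) ^ 2 by rw [corePairGF]; ring]
  refine HasSum.congr_fun h fun n => ?_
  ring

/-- The image of `corePairGF` under the `k`-th power of the operator `U₂`. -/
noncomputable def iterU (k : ℕ) (q : ℂ) : ℂ :=
  (B k : ℂ) * cusp q - 8 * (B (k - 1) : ℂ) * cusp (q ^ 2) +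
    (8 ^ (k + 1) - 1) / 7 * corePairGF q - (8 ^ (k + 1) - 8) / 7 * corePairGF (q ^ 2)

lemma iterU_even_part (k : ℕ) {w : ℂ} (hw0 : w ≠ 0) (hw : ‖w‖ < 1) :
    (iterU k w + iterU k (-w)) / 2 = iterU (k + 1) (w ^ 2) := by
  have h1 := cusp_even_part hw0 hw
  have h2 := corePairGF_even_part hw0 hw
  -- Also valid at k = 0, where truncated subtraction reads B (0 - 1) as B 0 = 0.
  have hB : (B (k + 1) : ℂ) = -4 * B k - 8 * B (k - 1) + (8 ^ (k + 1) - 1) / 7 := by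
    cases k with
    | zero => norm_num [B]
    | succ k => rw [B]; push_cast; rfl
  simp only [iterU, neg_sq, ← pow_mul]
  rw [hB, Nat.add_sub_cancel]
  norm_num
  linear_combination (B k : ℂ) * h1 + (8 ^ (k + 1) - 1) / 7 * h2

/-- With q = w², averaging the series at w and -w kills the odd exponents, and `iterU_even_part`
evaluates the average. -/
lemma hasSum_coeffA_two_pow (k : ℕ) {q : ℂ} (hq0 : q ≠ 0) (hq : ‖q‖ < 1) :
    HasSum (fun n : ℕ => coeffA (2 ^ k * n) * q ^ n) (iterU k q) := by
  induction k generalizing q with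
  | zero =>
    have h0 : iterU 0 q = corePairGF q := by norm_num [iterU, B]
    simpa [h0] using hasSum_coeffA hq0 hq
  | succ k ih =>
    obtain ⟨w, rfl⟩ := IsAlgClosed.exists_pow_nat_eq q two_pos
    have hw0 : w ≠ 0 := fun h => hq0 (by rw [h]; norm_num)
    have hw : ‖w‖ < 1 := by
      rw [norm_pow] at hq
      exact (sq_lt_one_iff₀ (norm_nonneg w)).mp hq
    have h := ((ih hw0 hw).add (ih (neg_ne_zero.mpr hw0) (by rwa [norm_neg]))).div_const 2
    rw [iterU_even_part k hw0 hw] at h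
    have hinj : Function.Injective fun n : ℕ => 2 * n := mul_right_injective₀ two_ne_zero
    have h' := (hinj.hasSum_iff fun n hn => ?_).mpr h
    · refine HasSum.congr_fun h' fun n => ?_
      simp only [Function.comp]
      rw [(even_two_mul n).neg_pow, ← pow_mul, pow_succ, mul_assoc]
      ring
    · have hodd : Odd n := by
        rw [← Nat.not_even_iff_odd]
        rintro ⟨m, rfl⟩
        exact hn ⟨m, two_mul m⟩
      rw [hodd.neg_pow]
      ring

lemma coeffA_eq (k : ℕ) (hk : 1 ≤ k) (n : ℤ) (hn : -1 ≤ n) :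
    coeffA (2 ^ k * (n + 2).toNat) = A 5 (2 ^ k * n + 2 ^ (k + 1) - 2).toNat := by
  have h1 : (2 : ℕ) ≤ 2 ^ k := by
    simpa using Nat.pow_le_pow_right two_pos hk
  have h2 : (1 : ℕ) ≤ (n + 2).toNat := by lia
  have h3 : 2 ≤ 2 ^ k * (n + 2).toNat := h1.trans (Nat.le_mul_of_pos_right _ h2)
  rw [coeffA, if_pos h3]
  congr 2
  have h4 : ((n + 2).toNat : ℤ) = n + 2 := Int.toNat_of_nonneg (by lia)
  have h5 : ((2 ^ k * (n + 2).toNat : ℕ) : ℤ) = 2 ^ k * n + 2 ^ (k + 1) := by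
    push_cast
    rw [h4]
    ring
  lia

end CorePairs

theorem theorem1p1 (k : ℕ) (hk : 1 ≤ k) (q : ℂ) (hq0 : q ≠ 0) (hq1 : ‖q‖ < 1) :
    HasSum
      (fun n : Set.Ici (-1 : ℤ) =>
        (CorePairs.A 5 (2 ^ k * (n : ℤ) + 2 ^ (k + 1) - 2).toNat : ℂ) * q ^ (n : ℤ))
      ((CorePairs.B k : ℂ) * (CorePairs.f 1 q ^ 4 * CorePairs.f 5 q ^ 4 / q)
        - 8 * (CorePairs.B (k - 1) : ℂ) * CorePairs.f 2 q ^ 4 * CorePairs.f 10 q ^ 4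
        + (8 ^ (k + 1) - 1) / 7 * (CorePairs.f 5 q ^ 10 / CorePairs.f 1 q ^ 2)
        - (8 ^ (k + 1) - 8) / 7 * (q ^ 2 * CorePairs.f 10 q ^ 10 / CorePairs.f 2 q ^ 2)) := by
  have h := CorePairs.hasSum_coeffA_two_pow k hq0 hq1
  have hinj : Function.Injective fun n : Set.Ici (-1 : ℤ) => ((n : ℤ) + 2).toNat := by
    rintro ⟨a, ha⟩ ⟨b, hb⟩ hab
    simp only [Set.mem_Ici] at ha hb hab
    exact Subtype.ext (by simp only; lia)
  -- The index is m = n + 2, so n ≥ -1 omits only m = 0, where the coefficient vanishes.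
  have hout : ∀ m ∉ Set.range fun n : Set.Ici (-1 : ℤ) => ((n : ℤ) + 2).toNat,
      CorePairs.coeffA (2 ^ k * m) * q ^ m = 0 := by
    intro m hm
    have hm0 : m = 0 := by
      by_contra hne
      exact hm ⟨⟨(m : ℤ) - 2, Set.mem_Ici.mpr (by lia)⟩, by simp⟩
    simp [hm0, CorePairs.coeffA]
  have h' := ((hinj.hasSum_iff hout).mpr h).mul_left (q ^ 2)⁻¹
  have hval : (q ^ 2)⁻¹ * CorePairs.iterU k q =
      (CorePairs.B k : ℂ) * (CorePairs.f 1 q ^ 4 * CorePairs.f 5 q ^ 4 / q)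
        - 8 * (CorePairs.B (k - 1) : ℂ) * CorePairs.f 2 q ^ 4 * CorePairs.f 10 q ^ 4
        + (8 ^ (k + 1) - 1) / 7 * (CorePairs.f 5 q ^ 10 / CorePairs.f 1 q ^ 2)
        - (8 ^ (k + 1) - 8) / 7 *
          (q ^ 2 * CorePairs.f 10 q ^ 10 / CorePairs.f 2 q ^ 2) := by
    simp only [CorePairs.iterU, CorePairs.cusp, CorePairs.corePairGF, CorePairs.f_pow]
    norm_num
    field_simp
  rw [hval] at h'
  refine HasSum.congr_fun h' fun n => ?_
  have hn : ((n : ℤ) + 2).toNat = (n : ℤ) + 2 := Int.toNat_of_nonneg (by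
    have := Set.mem_Ici.mp n.2
    lia)
  simp only [Function.comp]
  rw [CorePairs.coeffA_eq k hk n (Set.mem_Ici.mp n.2), ← zpow_natCast q (Int.toNat _), hn,
    zpow_add₀ hq0, zpow_ofNat]
  field_simp
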